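/- Let $n\ge 0$ and $0\le l\le n$ be integers, put $k=n-l$, and let $\varepsilon_i=1$ for $1\le i\le k$ and $\varepsilon_i=-1$ for $k+1\le i\le n$. The reflection algebra $B(n,l)$ is the unital associative algebra over $\mathbb{C}$ with generators $b_{ij}^{(r)}$, where $1\le i,j\le n$ and $r=1,2,\dots$, subject to the following defining relations. Put $$b_{ij}(u)=\sum_{r\ge 0} b_{ij}^{(r)}u^{-r},\qquad b_{ij}^{(0)}=\delta_{ij}\varepsilon_i,\qquad B(u)=\sum_{i,j=1}^n b_{ij}(u)\otimes E_{ij},$$ where the $E_{ij}$ are the matrix units in $\mathrm{End}\,\mathbb{C}^n$, and let $B_1(u)$, $B_2(u)$ denote $B(u)$ acting in the first and the second copy of $\mathrm{End}\,\mathbb{C}^n$ in $\mathrm{End}\,\mathbb{C}^n\otimes\mathrm{End}\,\mathbb{C}^n$. Let $R(u)=1-P\,u^{-1}$ with $P=\sum_{i,j}E_{ij}\otimes E_{ji}$. The relations are the reflection equation $$R(u-v)\,B_1(u)\,R(u+v)\,B_2(v)=B_2(v)\,R(u+v)\,B_1(u)\,R(u-v)$$ (an identity of formal series in $u^{-1},v^{-1}$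 after multiplication by $u^2-v^2$) and the unitary condition $$B(u)\,B(-u)=1 .$$ Then, given any total ordering on (the index set of) the family of elements $$b_{ij}^{(2p-1)},\qquad 1\le i,j\le k\quad\text{or}\quad k+1\le i,j\le n,$$ $$b_{ij}^{(2p)},\qquad 1\le i\le k<j\le n\quad\text{or}\quad 1\le j\le k<i\le n,$$ with $p=1,2,\dots$, the ordered monomials in these elements constitute a basis of $B(n,l)$ as a complex vector space. -/

import Mathlib

namespace ReflAlg

open scoped Kronecker PowerSeries

/-- The sign `ε_i` for `i` in `{0, …, n-1}`: it is `1` on the first `k = n - l` indices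
and `-1` on the last `l` indices. -/
noncomputable def sgn (n l : ℕ) (i : Fin n) : ℂ := if (i : ℕ) + l < n then 1 else -1

/-- `i` and `j` lie in the same block of the decomposition `n = k + l`: both are among the first
`k = n - l` indices or both are among the last `l` indices. -/
def SameBlock (n l : ℕ) (i j : Fin n) : Prop := (i : ℕ) + l < n ↔ (j : ℕ) + l < n

section Series

variable {A : Type*} [Ring A] {n : ℕ}

/-- The flip `P = ∑ E_{ij} ⊗ E_{ji}` of `ℂⁿ ⊗ ℂⁿ`, as a matrix over a ring. -/
noncomputable def flipMatrix (S : Type*) [Ring S] (n : ℕ) : Matrix (Fin n × Fin n) (Fin n × Fin n) S :=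
  Matrix.of fun p q => if p.1 = q.2 ∧ p.2 = q.1 then 1 else 0

/-- The variable `x = u⁻¹` of `A[[u⁻¹, v⁻¹]]`, realised as `A⟦X⟧⟦X⟧` with inner variable `u⁻¹`
and outer variable `v⁻¹`. -/
noncomputable def xvar (A : Type*) [Ring A] : A⟦X⟧⟦X⟧ := PowerSeries.C PowerSeries.X

/-- The variable `y = v⁻¹` of `A[[u⁻¹, v⁻¹]]`. -/
noncomputable def yvar (A : Type*) [Ring A] : A⟦X⟧⟦X⟧ := PowerSeries.X

/-- The Yang `R`-matrix `R(u - v) = 1 - P (u - v)⁻¹` cleared of its denominator. With `x = u⁻¹`,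
`y = v⁻¹` one has `(u - v)⁻¹ = xy / (y - x)`, and this is `(y - x) R(u - v) = (y - x) - xy P`. -/
noncomputable def RMinus (A : Type*) [Ring A] (n : ℕ) : Matrix (Fin n × Fin n) (Fin n × Fin n) A⟦X⟧⟦X⟧ :=
  (yvar A - xvar A) • (1 : Matrix (Fin n × Fin n) (Fin n × Fin n) A⟦X⟧⟦X⟧)
    - (xvar A * yvar A) • flipMatrix A⟦X⟧⟦X⟧ n

/-- The Yang `R`-matrix `R(u + v) = 1 - P (u + v)⁻¹` cleared of its denominator:
`(y + x) R(u + v) = (y + x) - xy P`, where `x = u⁻¹`, `y = v⁻¹`. -/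
noncomputable def RPlus (A : Type*) [Ring A] (n : ℕ) : Matrix (Fin n × Fin n) (Fin n × Fin n) A⟦X⟧⟦X⟧ :=
  (yvar A + xvar A) • (1 : Matrix (Fin n × Fin n) (Fin n × Fin n) A⟦X⟧⟦X⟧)
    - (xvar A * yvar A) • flipMatrix A⟦X⟧⟦X⟧ n

/-- The matrix `B(u) = (b_{ij}(u))`, `b_{ij}(u) = ∑_{r ≥ 0} b_{ij}^{(r)} u^{-r}`, over
`A[[u⁻¹, v⁻¹]]`. -/
noncomputable def seriesU (b : Fin n → Fin n → ℕ → A) : Matrix (Fin n) (Fin n) A⟦X⟧⟦X⟧ :=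
  Matrix.of fun i j => PowerSeries.C (PowerSeries.mk fun r => b i j r)

/-- The matrix `B(v)` over `A[[u⁻¹, v⁻¹]]`. -/
noncomputable def seriesV (b : Fin n → Fin n → ℕ → A) : Matrix (Fin n) (Fin n) A⟦X⟧⟦X⟧ :=
  Matrix.of fun i j => PowerSeries.mk fun r => PowerSeries.C (b i j r)

/-- `B₁(u) = B(u) ⊗ 1`. -/
noncomputable def matB1 (b : Fin n → Fin n → ℕ → A) : Matrix (Fin n × Fin n) (Fin n × Fin n) A⟦X⟧⟦X⟧ :=
  seriesU b ⊗ₖ (1 : Matrix (Fin n) (Fin n) A⟦X⟧⟦X⟧)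

/-- `B₂(v) = 1 ⊗ B(v)`. -/
noncomputable def matB2 (b : Fin n → Fin n → ℕ → A) : Matrix (Fin n × Fin n) (Fin n × Fin n) A⟦X⟧⟦X⟧ :=
  (1 : Matrix (Fin n) (Fin n) A⟦X⟧⟦X⟧) ⊗ₖ seriesV b

/-- The left-hand side `R(u-v) B₁(u) R(u+v) B₂(v)` of the reflection equation, times the scalar
`(y - x)(y + x)`. -/
noncomputable def reflLHS (b : Fin n → Fin n → ℕ → A) : Matrix (Fin n × Fin n) (Fin n × Fin n) A⟦X⟧⟦X⟧ :=
  RMinus A n * matB1 b * RPlus A n * matB2 b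

/-- The right-hand side `B₂(v) R(u+v) B₁(u) R(u-v)` of the reflection equation, times the same
scalar `(y - x)(y + x)`. -/
noncomputable def reflRHS (b : Fin n → Fin n → ℕ → A) : Matrix (Fin n × Fin n) (Fin n × Fin n) A⟦X⟧⟦X⟧ :=
  matB2 b * RPlus A n * matB1 b * RMinus A n

/-- The product `B(u) B(-u)`, a matrix over `A[[u⁻¹]]`. -/
noncomputable def unitaryProd (b : Fin n → Fin n → ℕ → A) : Matrix (Fin n) (Fin n) A⟦X⟧ :=
  (Matrix.of fun i j => PowerSeries.mk fun r => b i j r) *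
    (Matrix.of fun i j => PowerSeries.mk fun r => (-1) ^ r * b i j r)

end Series

/-- The free algebra on symbols `b_{ij}^{(r)}`, `i, j` in `{0, …, n-1}`, `r ≥ 1`. -/
abbrev Free (n : ℕ) : Type := FreeAlgebra ℂ (Fin n × Fin n × ℕ+)

/-- The symbols `b_{ij}^{(r)}` for `r ≥ 0` in the free algebra, where
`b_{ij}^{(0)} = δ_{ij} ε_i`. -/
noncomputable def freeB (n l : ℕ) (i j : Fin n) : ℕ → Free n
  | 0 => if i = j then algebraMap ℂ (Free n) (sgn n l i) else 0
  | r + 1 => FreeAlgebra.ι ℂ (i, j, r.succPNat)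

/-- The defining relations: all coefficients of all matrix entries of the reflection equation
`R(u-v) B₁(u) R(u+v) B₂(v) = B₂(v) R(u+v) B₁(u) R(u-v)` and of the unitary condition
`B(u) B(-u) = 1`. -/
inductive Rel (n l : ℕ) : Free n → Free n → Prop
  | reflection (p q : Fin n × Fin n) (c d : ℕ) :
      Rel n l (PowerSeries.coeff c (PowerSeries.coeff d (reflLHS (freeB n l) p q)))
        (PowerSeries.coeff c (PowerSeries.coeff d (reflRHS (freeB n l) p q)))
  | unitary (i j : Fin n) (c : ℕ) :
      Rel n l (PowerSeries.coeff c (unitaryProd (freeB n l) i j))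
        (PowerSeries.coeff c ((1 : Matrix (Fin n) (Fin n) (Free n)⟦X⟧) i j))

end ReflAlg

/-- The reflection algebra `B(n,l)`. -/
def ReflectionAlgebra (n l : ℕ) : Type := RingQuot (ReflAlg.Rel n l)

namespace ReflectionAlgebra

noncomputable instance (n l : ℕ) : Ring (ReflectionAlgebra n l) :=
  inferInstanceAs (Ring (RingQuot (ReflAlg.Rel n l)))

noncomputable instance (n l : ℕ) : Algebra ℂ (ReflectionAlgebra n l) :=
  inferInstanceAs (Algebra ℂ (RingQuot (ReflAlg.Rel n l)))

/-- The element `b_{ij}^{(r)}` of `B(n,l)`, `r ≥ 0`, with `b_{ij}^{(0)} = δ_{ij} ε_i`. -/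
noncomputable def b (n l : ℕ) (i j : Fin n) (r : ℕ) : ReflectionAlgebra n l :=
  RingQuot.mkAlgHom ℂ (ReflAlg.Rel n l) (ReflAlg.freeB n l i j r)

/-- Index set of the PBW generators: triples `(i, j, r)` with `r ≥ 1` where either `r` is odd and
`i, j` are in the same block, or `r` is even and `i, j` are in different blocks. -/
structure PBWIndex (n l : ℕ) where
  row : Fin n
  col : Fin n
  level : ℕ
  level_pos : 1 ≤ level
  parity : (Odd level ∧ ReflAlg.SameBlock n l row col) ∨
    (Even level ∧ ¬ ReflAlg.SameBlock n l row col)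

/-- The PBW generator `b_{ij}^{(r)}` with index `g = (i, j, r)`. -/
noncomputable def pbwGen {n l : ℕ} (g : PBWIndex n l) : ReflectionAlgebra n l :=
  b n l g.row g.col g.level

end ReflectionAlgebra

/-! Give $b_{ij}^{(r)}$ the weight $3r-1$ and filter the algebra by the weight of words. The
$P$-terms of the reflection equation show that the commutator of $b_{ij}^{(r)}$ and $b_{i'j'}^{(s)}$
has weight at most $3(r+s)-3$, one less than that of the product (`commutator_mem`). So reordering a
word costs only lower terms. The unitary condition reads
$((-1)^r\varepsilon_i+\varepsilon_j)\,b_{ij}^{(r)}=$ quadratic terms of weight at most $3r-2$. The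
scalar on the left is nonzero for every generator outside the PBW family, so such generators reduce
to lower weight. Induction on weight then shows that sorted words in the PBW family span
(`wordSpan_le_span_sorted`).

Independence comes from operators that imitate partial derivatives. With $p=\sum E_{ij}\otimes
e_{ji}$ and $L(u)=1-p(u-a)^{-1}$, the Yang–Baxter equation shows that $L(u)B(u)L(-u)^{-1}$ satisfies
the same relations as $B(u)$ (`IsReflectionFamily.dressed`). This gives a homomorphism `coaction`
from $B(n,l)$ to $n\times n$ matrices over $B(n,l)[a]$. To first order it sends $b_{ij}^{(r+1)}$ to
$b_{ij}^{(r+1)}-(\varepsilon_j+(-1)^r\varepsilon_i)\,a^r e_{ji}$, and this scalar is nonzero on the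
PBW family.

With $a$ in degree $3$, `coaction` minus the constant embedding lowers weight by $2$, so the product
of two such differences is negligible. The coefficient of $a^{r-1}$ in the entry $(j,i)$ is
therefore, up to lower weight, a derivation sending $b_{ij}^{(r)}$ to a nonzero scalar and every
other PBW generator to zero. In a linear relation among sorted words, take a word of maximal weight,
apply the operators of its letters and then a character. All other words die, while this one gives a
nonzero scalar, a product of leading coefficients and multiplicities. Hence its coefficient vanishes
(`linearIndependent_sorted_words`). -/

namespace ReflAlg

open scoped Kronecker PowerSeries

/-! ### Tensor factors and the flip over a noncommutative ring -/

section Kron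

variable {R : Type*} [Ring R] {n : ℕ}

/-- The embedding `A ↦ A ⊗ 1` into the first tensor factor, over a not necessarily commutative
ring. -/
noncomputable def inFst (R : Type*) [Ring R] (n : ℕ) :
    Matrix (Fin n) (Fin n) R →+* Matrix (Fin n × Fin n) (Fin n × Fin n) R where
  toFun A := A ⊗ₖ (1 : Matrix (Fin n) (Fin n) R)
  map_one' := by
    ext ⟨i, k⟩ ⟨j, m⟩
    by_cases h : i = j <;> by_cases h' : k = m <;> simp [Matrix.one_apply, h, h']
  map_mul' A B := by
    ext ⟨i, k⟩ ⟨j, m⟩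
    by_cases h' : k = m <;>
      simp [Matrix.mul_apply, Fintype.sum_prod_type, Matrix.one_apply, h']
  map_zero' := by ext; simp
  map_add' A B := by ext; simp [add_mul]

/-- The embedding `A ↦ 1 ⊗ A` into the second tensor factor, over a not necessarily commutative
ring. -/
noncomputable def inSnd (R : Type*) [Ring R] (n : ℕ) :
    Matrix (Fin n) (Fin n) R →+* Matrix (Fin n × Fin n) (Fin n × Fin n) R where
  toFun A := (1 : Matrix (Fin n) (Fin n) R) ⊗ₖ A
  map_one' := by
    ext ⟨i, k⟩ ⟨j, m⟩
    by_cases h : i = j <;> by_cases h' : k = m <;> simp [Matrix.one_apply, h, h']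
  map_mul' A B := by
    ext ⟨i, k⟩ ⟨j, m⟩
    by_cases h' : i = j <;>
      simp [Matrix.mul_apply, Fintype.sum_prod_type, Matrix.one_apply, h']
  map_zero' := by ext; simp
  map_add' A B := by ext; simp [mul_add]

lemma inFst_apply (A : Matrix (Fin n) (Fin n) R) (p q : Fin n × Fin n) :
    inFst R n A p q = if p.2 = q.2 then A p.1 q.1 else 0 := by
  simp [inFst, Matrix.one_apply]

lemma inSnd_apply (A : Matrix (Fin n) (Fin n) R) (p q : Fin n × Fin n) :
    inSnd R n A p q = if p.1 = q.1 then A p.2 q.2 else 0 := by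
  simp [inSnd, Matrix.one_apply]

lemma inFst_mul_inSnd_apply (A B : Matrix (Fin n) (Fin n) R) (p q : Fin n × Fin n) :
    (inFst R n A * inSnd R n B) p q = A p.1 q.1 * B p.2 q.2 := by
  simp [Matrix.mul_apply, Fintype.sum_prod_type, inFst_apply, inSnd_apply]

lemma inSnd_mul_inFst_apply (A B : Matrix (Fin n) (Fin n) R) (p q : Fin n × Fin n) :
    (inSnd R n B * inFst R n A) p q = B p.2 q.2 * A p.1 q.1 := by
  simp [Matrix.mul_apply, Fintype.sum_prod_type, inFst_apply, inSnd_apply]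

lemma commute_inFst_inSnd {A B : Matrix (Fin n) (Fin n) R}
    (h : ∀ i j k m, Commute (A i j) (B k m)) : Commute (inFst R n A) (inSnd R n B) := by
  ext p q
  rw [inFst_mul_inSnd_apply, inSnd_mul_inFst_apply]
  exact h _ _ _ _

lemma flipMatrix_mul_apply (M : Matrix (Fin n × Fin n) (Fin n × Fin n) R) (p q : Fin n × Fin n) :
    (flipMatrix R n * M) p q = M p.swap q := by
  obtain ⟨i, k⟩ := p
  simp [Matrix.mul_apply, Fintype.sum_prod_type, flipMatrix, ite_and]

lemma mul_flipMatrix_apply (M : Matrix (Fin n × Fin n) (Fin n × Fin n) R) (p q : Fin n × Fin n) :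
    (M * flipMatrix R n) p q = M p q.swap := by
  obtain ⟨i, k⟩ := q
  simp [Matrix.mul_apply, Fintype.sum_prod_type, flipMatrix, ite_and]

lemma flipMatrix_mul_self : flipMatrix R n * flipMatrix R n = 1 := by
  ext ⟨i, k⟩ ⟨j, m⟩
  rw [flipMatrix_mul_apply]
  simp [flipMatrix, Matrix.one_apply, and_comm]

lemma flipMatrix_mul_inFst (A : Matrix (Fin n) (Fin n) R) :
    flipMatrix R n * inFst R n A = inSnd R n A * flipMatrix R n := by
  ext p q
  rw [flipMatrix_mul_apply, mul_flipMatrix_apply]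
  simp [inFst_apply, inSnd_apply]

lemma flipMatrix_mul_inSnd (A : Matrix (Fin n) (Fin n) R) :
    flipMatrix R n * inSnd R n A = inFst R n A * flipMatrix R n := by
  ext p q
  rw [flipMatrix_mul_apply, mul_flipMatrix_apply]
  simp [inFst_apply, inSnd_apply]

end Kron

/-! ### Yang–Baxter equations from the relations between transpositions -/

section YangBaxter

variable {Z M : Type*} [CommRing Z] [Ring M]

/-- The Yang–Baxter equation for rational `R`-matrices in a ring containing three transpositions
`P = (12)`, `P₁ = (10)`, `P₂ = (20)`. -/
lemma yang_baxter [Algebra Z M] {P P₁ P₂ : M} (hPP : P * P = 1)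
    (h22 : P₂ * P₂ = 1) (hP1 : P * P₁ = P₂ * P) (hP2 : P * P₂ = P₁ * P)
    (h12 : P₁ * P₂ = P * P₁) (h21 : P₂ * P₁ = P * P₂) {α γ t τ : Z}
    (h : γ * (τ - t) = α * (t * τ)) :
    (α • (1 : M) - γ • P) * ((1 - t • P₁) * (1 - τ • P₂)) =
      (1 - τ • P₂) * (1 - t • P₁) * (α • (1 : M) - γ • P) := by
  have e1 : P * (P₁ * P₂) = P₁ := by rw [← mul_assoc, ← h12, mul_assoc, h22, mul_one]
  have e2 : P₂ * P₁ * P = P₁ := by rw [h21, mul_assoc, ← hP1, ← mul_assoc, hPP, one_mul]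
  simp only [mul_sub, sub_mul, mul_one, one_mul, smul_mul_assoc, mul_smul_comm, smul_sub, smul_smul,
    e1, e2, ← hP1, ← hP2, ← h12, ← h21]
  -- With $P P_1=P_1P_2$ and $P P_2=P_2P_1$, the two sides differ by $\alpha t\tau-\gamma(\tau-t)$
  -- times the commutator of $P_1$ and $P_2$. For $t=(u-a)^{-1}$ and $\tau=(v-a)^{-1}$, hypothesis
  -- `h` says $1/t-1/\tau=u-v$.
  linear_combination (norm := module) (-h) • (P₁ * P₂ - P₂ * P₁)

/-- The mixed form of the Yang–Baxter equation. -/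
lemma yang_baxter_mixed [Algebra Z M] {P P₁ P₂ : M} (h11 : P₁ * P₁ = 1)
    (h22 : P₂ * P₂ = 1) (hP1 : P * P₁ = P₂ * P) (hP2 : P * P₂ = P₁ * P)
    (h12 : P₁ * P₂ = P * P₁) (h21 : P₂ * P₁ = P * P₂) {β γ t τ : Z}
    (h : γ * (τ + t) = β * (t * τ)) :
    (1 - t • P₁) * (β • (1 : M) - γ • P) * (1 - τ • P₂) =
      (1 - τ • P₂) * (β • (1 : M) - γ • P) * (1 - t • P₁) := by
  have e1 : P₂ * P₁ * P₂ = P := by rw [h21, mul_assoc, h22, mul_one]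
  have e2 : P₁ * P₂ * P₁ = P := by rw [h12, mul_assoc, h11, mul_one]
  simp only [mul_sub, sub_mul, mul_one, one_mul, smul_mul_assoc, mul_smul_comm, smul_sub, smul_smul,
    ← hP1, ← hP2, ← h12, ← h21, e1, e2]
  linear_combination (norm := module) (-h) • (P₁ * P₂ - P₂ * P₁)

end YangBaxter
end ReflAlg

namespace ReflAlg

open scoped Kronecker PowerSeries

/-! ### Dressing a solution of the reflection equation, abstractly -/

section AbstractDressing

variable {Z M : Type*} [CommRing Z] [Ring M]

/-- Multiplying a solution of the reflection equation by rational `L`-operators on both sides gives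
another solution. -/
lemma dressed_reflection [Algebra Z M] {P P₁ P₂ B₁ B₂ : M} (hPP : P * P = 1) (h11 : P₁ * P₁ = 1)
    (h22 : P₂ * P₂ = 1) (hP1 : P * P₁ = P₂ * P) (hP2 : P * P₂ = P₁ * P)
    (h12 : P₁ * P₂ = P * P₁) (h21 : P₂ * P₁ = P * P₂)
    (c1 : Commute B₁ P₂) (c2 : Commute B₂ P₁) {α β γ t t' τ τ' s σ : Z}
    (h : (α • (1 : M) - γ • P) * B₁ * (β • (1 : M) - γ • P) * B₂ =
      B₂ * (β • (1 : M) - γ • P) * B₁ * (α • (1 : M) - γ • P))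
    (e1 : γ * (τ - t) = α * (t * τ)) (e2 : γ * (τ' - t') = α * (t' * τ'))
    (e3 : γ * (τ + t') = β * (t' * τ)) (e4 : γ * (τ' + t) = β * (t * τ')) :
    (α • (1 : M) - γ • P) * ((1 - t • P₁) * B₁ * (s • (1 - t' • P₁))) * (β • (1 : M) - γ • P) *
        ((1 - τ • P₂) * B₂ * (σ • (1 - τ' • P₂))) =
      ((1 - τ • P₂) * B₂ * (σ • (1 - τ' • P₂))) * (β • (1 : M) - γ • P) *
        ((1 - t • P₁) * B₁ * (s • (1 - t' • P₁))) * (α • (1 : M) - γ • P) := by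
  have y1 := yang_baxter hPP h22 hP1 hP2 h12 h21 e1
  have y2 := yang_baxter hPP h22 hP1 hP2 h12 h21 e2
  have y3 := yang_baxter_mixed h11 h22 hP1 hP2 h12 h21 e3
  have y4 := yang_baxter_mixed h11 h22 hP1 hP2 h12 h21 e4
  have d1 : Commute B₁ (1 - τ • P₂) := (Commute.one_right _).sub_right (c1.smul_right _)
  have d1' : Commute B₁ (1 - τ' • P₂) := (Commute.one_right _).sub_right (c1.smul_right _)
  have d2 : Commute B₂ (1 - t • P₁) := (Commute.one_right _).sub_right (c2.smul_right _)
  have d2' : Commute B₂ (1 - t' • P₁) := (Commute.one_right _).sub_right (c2.smul_right _)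
  simp only [mul_smul_comm, smul_mul_assoc, smul_smul, mul_comm σ s]
  congr 1
  generalize α • (1 : M) - γ • P = ρ at *
  generalize β • (1 : M) - γ • P = ρ' at *
  generalize 1 - t • P₁ = L₁ at *
  generalize 1 - τ • P₂ = L₂ at *
  generalize 1 - t' • P₁ = K₁ at *
  generalize 1 - τ' • P₂ = K₂ at *
  -- The mixed equation `y3` and the commutations between different tensor factors bring both $L$'s
  -- to the left and both $K$'s to the right. This isolates the undressed equation `h`; then `y2`
  -- and `y4` return the factors in the opposite order.
  calc ρ * (L₁ * B₁ * K₁) * ρ' * (L₂ * B₂ * K₂)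
      = ρ * L₁ * B₁ * (K₁ * ρ' * L₂) * B₂ * K₂ := by simp only [mul_assoc]
    _ = ρ * L₁ * (B₁ * L₂) * ρ' * (K₁ * B₂) * K₂ := by rw [y3]; simp only [mul_assoc]
    _ = (ρ * (L₁ * L₂)) * B₁ * ρ' * B₂ * K₁ * K₂ := by
        rw [d1.eq, ← d2'.eq]; simp only [mul_assoc]
    _ = L₂ * L₁ * (ρ * B₁ * ρ' * B₂) * (K₁ * K₂) := by rw [y1]; simp only [mul_assoc]
    _ = L₂ * L₁ * B₂ * ρ' * B₁ * (ρ * (K₁ * K₂)) := by rw [h]; simp only [mul_assoc]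
    _ = L₂ * (L₁ * B₂) * ρ' * (B₁ * K₂) * K₁ * ρ := by rw [y2]; simp only [mul_assoc]
    _ = L₂ * B₂ * (L₁ * ρ' * K₂) * B₁ * K₁ * ρ := by
        rw [d1'.eq, ← d2.eq]; simp only [mul_assoc]
    _ = _ := by rw [y4]; simp only [mul_assoc]

end AbstractDressing

/-! ### Generating series and their behaviour under ring homomorphisms -/

section Series

variable {S : Type*} [Ring S] {n : ℕ}

/-- The matrix `B(u)` over `S⟦u⁻¹⟧`. -/
noncomputable def bSeries (b : Fin n → Fin n → ℕ → S) : Matrix (Fin n) (Fin n) S⟦X⟧ :=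
  Matrix.of fun i j => PowerSeries.mk fun r => b i j r

/-- The substitution `u ↦ -u` on series with coefficients in a not necessarily commutative ring. -/
noncomputable def negArg (S : Type*) [Ring S] : S⟦X⟧ →+* S⟦X⟧ where
  toFun f := PowerSeries.mk fun r => (-1) ^ r * PowerSeries.coeff r f
  map_one' := by
    ext r
    cases r <;> simp [PowerSeries.coeff_one]
  map_mul' f g := by
    ext r
    simp only [PowerSeries.coeff_mk, PowerSeries.coeff_mul, Finset.mul_sum]
    refine Finset.sum_congr rfl fun x hx => ?_
    rw [← Finset.HasAntidiagonal.mem_antidiagonal.1 hx, pow_add, mul_assoc, mul_assoc,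
      ← mul_assoc (PowerSeries.coeff x.1 f),
      ← ((Commute.neg_one_left (PowerSeries.coeff x.1 f)).pow_left x.2).eq, mul_assoc]
  map_zero' := by ext; simp
  map_add' f g := by ext; simp [mul_add]

lemma coeff_negArg (f : S⟦X⟧) (r : ℕ) :
    PowerSeries.coeff r (negArg S f) = (-1) ^ r * PowerSeries.coeff r f := by
  simp [negArg]

lemma unitaryProd_eq (b : Fin n → Fin n → ℕ → S) :
    unitaryProd b = bSeries b * (negArg S).mapMatrix (bSeries b) := by
  unfold unitaryProd bSeries
  congr 1
  ext i j r
  simp [coeff_negArg]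

lemma matB1_eq (b : Fin n → Fin n → ℕ → S) :
    matB1 b = inFst _ n ((PowerSeries.C (R := S⟦X⟧)).mapMatrix (bSeries b)) := rfl

lemma matB2_eq (b : Fin n → Fin n → ℕ → S) :
    matB2 b = inSnd _ n ((PowerSeries.map (PowerSeries.C (R := S))).mapMatrix (bSeries b)) := by
  unfold matB2 inSnd
  simp only [RingHom.coe_mk, MonoidHom.coe_mk, OneHom.coe_mk]
  congr 1

/-- The family `b_{ij}^{(r)}` satisfies the reflection equation and the unitary condition. -/
structure IsReflectionFamily (b : Fin n → Fin n → ℕ → S) : Prop where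
  reflection : reflLHS b = reflRHS b
  unitary : unitaryProd b = 1

variable {T : Type*} [Ring T]

lemma map_flipMatrix {R R' : Type*} [Ring R] [Ring R'] (f : R →+* R') :
    f.mapMatrix (flipMatrix R n) = flipMatrix R' n := by
  ext p q
  simp [flipMatrix, apply_ite f]

lemma map_inFst {R R' : Type*} [Ring R] [Ring R'] (f : R →+* R') (A : Matrix (Fin n) (Fin n) R) :
    f.mapMatrix (inFst R n A) = inFst R' n (f.mapMatrix A) := by
  ext p q
  simp [inFst_apply, apply_ite f]

lemma map_inSnd {R R' : Type*} [Ring R] [Ring R'] (f : R →+* R') (A : Matrix (Fin n) (Fin n) R) :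
    f.mapMatrix (inSnd R n A) = inSnd R' n (f.mapMatrix A) := by
  ext p q
  simp [inSnd_apply, apply_ite f]

lemma map_matB1 (f : S →+* T) (b : Fin n → Fin n → ℕ → S) :
    (PowerSeries.map (PowerSeries.map f)).mapMatrix (matB1 b) =
      matB1 fun i j r => f (b i j r) := by
  rw [matB1_eq, map_inFst, matB1_eq]
  congr 1
  ext i j : 2
  simp only [RingHom.mapMatrix_apply, Matrix.map_apply, PowerSeries.map_C]
  congr 1

lemma map_matB2 (f : S →+* T) (b : Fin n → Fin n → ℕ → S) :
    (PowerSeries.map (PowerSeries.map f)).mapMatrix (matB2 b) =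
      matB2 fun i j r => f (b i j r) := by
  rw [matB2_eq, map_inSnd, matB2_eq]
  congr 1
  ext i j r : 3
  simp [bSeries]

/-- As products with scalar matrices, the two terms are transported by any ring homomorphism and can
be measured by a filtration. -/
lemma RMinus_eq : RMinus S n = Matrix.scalar _ (yvar S - xvar S) -
    Matrix.scalar _ (xvar S * yvar S) * flipMatrix _ n := by
  rw [RMinus, Matrix.smul_one_eq_diagonal, Matrix.smul_eq_diagonal_mul]
  rfl

lemma RPlus_eq : RPlus S n = Matrix.scalar _ (yvar S + xvar S) -
    Matrix.scalar _ (xvar S * yvar S) * flipMatrix _ n := by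
  rw [RPlus, Matrix.smul_one_eq_diagonal, Matrix.smul_eq_diagonal_mul]
  rfl

lemma mapMatrix_scalar {m R R' : Type*} [Fintype m] [DecidableEq m] [Ring R] [Ring R']
    (f : R →+* R') (r : R) :
    f.mapMatrix (Matrix.scalar m r) = Matrix.scalar m (f r) := by
  ext i j
  by_cases h : i = j <;> simp [h]

lemma map_xvar (f : S →+* T) : PowerSeries.map (PowerSeries.map f) (xvar S) = xvar T := by
  simp [xvar]

lemma map_yvar (f : S →+* T) : PowerSeries.map (PowerSeries.map f) (yvar S) = yvar T := by
  simp [yvar]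

lemma map_RMinus (f : S →+* T) :
    (PowerSeries.map (PowerSeries.map f)).mapMatrix (RMinus S n) = RMinus T n := by
  simp only [RMinus_eq, map_sub, map_mul, mapMatrix_scalar, map_xvar, map_yvar, map_flipMatrix]

lemma map_RPlus (f : S →+* T) :
    (PowerSeries.map (PowerSeries.map f)).mapMatrix (RPlus S n) = RPlus T n := by
  simp only [RPlus_eq, map_sub, map_add, map_mul, mapMatrix_scalar, map_xvar, map_yvar,
    map_flipMatrix]

lemma map_reflLHS (f : S →+* T) (b : Fin n → Fin n → ℕ → S) :
    (PowerSeries.map (PowerSeries.map f)).mapMatrix (reflLHS b) =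
      reflLHS fun i j r => f (b i j r) := by
  simp only [reflLHS, map_mul, map_RMinus, map_RPlus, map_matB1, map_matB2]

lemma map_reflRHS (f : S →+* T) (b : Fin n → Fin n → ℕ → S) :
    (PowerSeries.map (PowerSeries.map f)).mapMatrix (reflRHS b) =
      reflRHS fun i j r => f (b i j r) := by
  simp only [reflRHS, map_mul, map_RMinus, map_RPlus, map_matB1, map_matB2]

lemma map_unitaryProd (f : S →+* T) (b : Fin n → Fin n → ℕ → S) :
    (PowerSeries.map f).mapMatrix (unitaryProd b) = unitaryProd fun i j r => f (b i j r) := by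
  rw [unitaryProd, map_mul, unitaryProd]
  congr 1
  · ext i j r
    simp

end Series

/-! ### The dressed family $L(u)B(u)L(-u)^{-1}$ -/

section Dressing

variable {K S : Type*} [CommRing K] [Ring S] {n : ℕ}

/-- The expansion of `(u - a)⁻¹` as a series in `u⁻¹`. -/
noncomputable def shiftInv (a : K) : K⟦X⟧ := PowerSeries.mk fun r => if r = 0 then 0 else a ^ (r - 1)

lemma shiftInv_mul (a : K) : shiftInv a * (1 - PowerSeries.C a * PowerSeries.X) = PowerSeries.X := by
  ext r
  rw [mul_sub, mul_one, ← mul_assoc, mul_comm (shiftInv a), mul_assoc]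
  rcases r with _ | _ | r
  · simp [shiftInv]
  · simp [shiftInv, PowerSeries.coeff_succ_mul_X]
  · simp [shiftInv, PowerSeries.coeff_succ_mul_X, PowerSeries.coeff_X, pow_succ']

lemma negArg_shiftInv (a : K) : negArg K (shiftInv a) = -shiftInv (-a) := by
  ext r
  rcases r with _ | r
  · simp [shiftInv, coeff_negArg]
  · simp [shiftInv, coeff_negArg, pow_succ, neg_pow a]

/-- The scalar series `(1 - (u + a)⁻²)⁻¹`. -/
noncomputable def dressScalar (a : K) : K⟦X⟧ :=
  PowerSeries.invOfUnit (1 - shiftInv (-a) * shiftInv (-a)) 1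

lemma dressScalar_mul (a : K) :
    dressScalar a * (1 - shiftInv (-a) * shiftInv (-a)) = 1 := by
  rw [mul_comm, dressScalar]
  apply PowerSeries.mul_invOfUnit
  simp [shiftInv, PowerSeries.constantCoeff_mk]

/-- The ring homomorphism from scalar series to scalar matrices. -/
noncomputable def scalarSeries (κ : K →+* S) (n : ℕ) : K⟦X⟧ →+* Matrix (Fin n) (Fin n) S⟦X⟧ :=
  (Matrix.scalar (Fin n)).comp (PowerSeries.map κ)

/-- The matrix `∑ E_{ij} ⊗ e_{ji}`. -/
noncomputable def unitMatrix (e : Fin n → Fin n → S) : Matrix (Fin n) (Fin n) S⟦X⟧ :=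
  Matrix.of fun i j => PowerSeries.C (e j i)

/-- The matrix `L(u) B(u) L(-u)⁻¹` where `L(u) = 1 - p (u - a)⁻¹`. -/
noncomputable def dressedMatrix (κ : K →+* S) (a : K) (e : Fin n → Fin n → S)
    (b : Fin n → Fin n → ℕ → S) : Matrix (Fin n) (Fin n) S⟦X⟧ :=
  (1 - scalarSeries κ n (shiftInv a) * unitMatrix e) * bSeries b *
    (scalarSeries κ n (dressScalar a) *
      (1 - scalarSeries κ n (shiftInv (-a)) * unitMatrix e))

/-- The coefficients of `L(u) B(u) L(-u)⁻¹`. -/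
noncomputable def dressed (κ : K →+* S) (a : K) (e : Fin n → Fin n → S)
    (b : Fin n → Fin n → ℕ → S) (i j : Fin n) (r : ℕ) : S :=
  PowerSeries.coeff r (dressedMatrix κ a e b i j)

lemma bSeries_dressed (κ : K →+* S) (a : K) (e : Fin n → Fin n → S) (b : Fin n → Fin n → ℕ → S) :
    bSeries (dressed κ a e b) = dressedMatrix κ a e b := by
  ext i j r
  simp [bSeries, dressed]

lemma commute_map {κ : K →+* S} (hκ : ∀ k s, Commute (κ k) s) (f : K⟦X⟧) (g : S⟦X⟧) :
    Commute (PowerSeries.map κ f) g := by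
  ext r
  rw [PowerSeries.coeff_mul, PowerSeries.coeff_mul, ← Finset.Nat.sum_antidiagonal_swap]
  refine Finset.sum_congr rfl fun x _ => ?_
  simpa using (hκ _ _).eq

lemma commute_scalar {m R : Type*} [Fintype m] [DecidableEq m] [Ring R] {r : R}
    (h : ∀ s, Commute r s) (A : Matrix m m R) : Commute (Matrix.scalar m r) A :=
  Matrix.scalar_commute r h A

variable {κ : K →+* S} {a : K} {e : Fin n → Fin n → S} {b : Fin n → Fin n → ℕ → S}

/-- For matrix units `e`, this matrix is the flip of $\mathbb{C}^n$ with the auxiliary copy on which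
`e` acts. -/
lemma unitMatrix_mul_self (he : ∀ i j k m, e i j * e k m = if j = k then e i m else 0)
    (h1 : ∑ i, e i i = 1) : unitMatrix e * unitMatrix e = 1 := by
  ext i j : 2
  simp only [Matrix.mul_apply, unitMatrix, Matrix.of_apply, ← map_mul, he]
  rw [← map_sum]
  by_cases h : i = j
  · subst h; simp [h1]
  · simp [h]

lemma negArg_map (κ : K →+* S) (f : K⟦X⟧) :
    negArg S (PowerSeries.map κ f) = PowerSeries.map κ (negArg K f) := by
  ext r; simp [coeff_negArg]

lemma negArg_scalarSeries (f : K⟦X⟧) :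
    (negArg S).mapMatrix (scalarSeries κ n f) = scalarSeries κ n (negArg K f) := by
  simp only [scalarSeries, RingHom.comp_apply, mapMatrix_scalar, negArg_map]

lemma negArg_unitMatrix : (negArg S).mapMatrix (unitMatrix e) = unitMatrix e := by
  ext i j r
  cases r <;> simp [unitMatrix, coeff_negArg, PowerSeries.coeff_C]

/-- The inner factors $L(-u)^{-1}L(-u)$ cancel, then $B(u)B(-u)=1$, then the outer factors cancel.
Since $p^2=1$, inverting $1\pm tp$ amounts to inverting the scalar $1-t^2$. -/
lemma dressed_unitary (hκ : ∀ k s, Commute (κ k) s)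
    (he : ∀ i j k m, e i j * e k m = if j = k then e i m else 0)
    (h1 : ∑ i, e i i = 1) (hb : unitaryProd b = 1) : unitaryProd (dressed κ a e b) = 1 := by
  rw [unitaryProd_eq] at hb ⊢
  rw [bSeries_dressed]
  have hp := unitMatrix_mul_self he h1
  have hc : ∀ f A, Commute (scalarSeries κ n f) A := fun f A =>
    commute_scalar (fun s => commute_map hκ f s) A
  have hs := congrArg (scalarSeries κ n) (dressScalar_mul a)
  -- Under $u\mapsto-u$ the scalar that normalises $L(-u)^{-1}$ becomes the inverse of
  -- $1-(u-a)^{-2}$, as the outer factors require.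
  have hs' := congrArg (fun x => scalarSeries κ n (negArg K x)) (dressScalar_mul a)
  simp only [map_mul, map_sub, map_one, negArg_shiftInv, neg_neg, neg_mul_neg] at hs hs'
  simp only [dressedMatrix, map_mul, map_sub, map_one, negArg_scalarSeries, negArg_shiftInv,
    neg_neg, negArg_unitMatrix, map_neg, neg_mul, sub_neg_eq_add]
  generalize unitMatrix e = p at *
  have ht := hc (shiftInv a)
  have ht' := hc (shiftInv (-a))
  have hσ := hc (dressScalar a)
  have hσ' := hc (negArg K (dressScalar a))
  generalize scalarSeries κ n (shiftInv a) = t at *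
  generalize scalarSeries κ n (shiftInv (-a)) = t' at *
  generalize scalarSeries κ n (dressScalar a) = σ at *
  generalize scalarSeries κ n (negArg K (dressScalar a)) = σ' at *
  have k1 : (1 - t' * p) * (1 + t' * p) = 1 - t' * t' := by
    have : t' * p * (t' * p) = t' * t' := by
      rw [mul_assoc, ← mul_assoc p, ← (ht' p).eq, mul_assoc t' p p, hp, mul_one]
    rw [sub_mul, mul_add, mul_add, this]; simp; abel
  have k2 : (1 - t * p) * (1 + t * p) = 1 - t * t := by
    have : t * p * (t * p) = t * t := by
      rw [mul_assoc, ← mul_assoc p, ← (ht p).eq, mul_assoc t p p, hp, mul_one]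
    rw [sub_mul, mul_add, mul_add, this]; simp; abel
  generalize bSeries b = B at *
  generalize (negArg S).mapMatrix B = B' at *
  calc (1 - t * p) * B * (σ * (1 - t' * p)) * ((1 + t' * p) * B' * (σ' * (1 + t * p)))
      = (1 - t * p) * B * (σ * ((1 - t' * p) * (1 + t' * p))) * B' * (σ' * (1 + t * p)) := by
        simp only [mul_assoc]
    _ = (1 - t * p) * (B * B') * σ' * (1 + t * p) := by
        rw [k1, hs]; simp only [mul_assoc, one_mul]
    _ = σ' * ((1 - t * p) * (1 + t * p)) := by
        rw [hb, mul_one, ← (hσ' (1 - t * p)).eq, mul_assoc]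
    _ = 1 := by rw [k2, hs']

/-- The ring homomorphism from scalar series in two variables to scalar matrices. -/
noncomputable def scalarSeries₂ (κ : K →+* S) (n : ℕ) :
    K⟦X⟧⟦X⟧ →+* Matrix (Fin n × Fin n) (Fin n × Fin n) S⟦X⟧⟦X⟧ :=
  (Matrix.scalar (Fin n × Fin n)).comp (PowerSeries.map (PowerSeries.map κ))

lemma inFst_scalarSeries (f : K⟦X⟧) :
    inFst _ n ((PowerSeries.C (R := S⟦X⟧)).mapMatrix (scalarSeries κ n f)) =
      scalarSeries₂ κ n (PowerSeries.C f) := by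
  ext p q : 2
  simp only [scalarSeries, scalarSeries₂, RingHom.comp_apply, mapMatrix_scalar, PowerSeries.map_C]
  obtain ⟨i, k⟩ := p
  obtain ⟨j, m⟩ := q
  by_cases h : i = j <;> by_cases h' : k = m <;> simp [inFst_apply, h, h']

lemma inSnd_scalarSeries (f : K⟦X⟧) :
    inSnd _ n ((PowerSeries.map (PowerSeries.C (R := S))).mapMatrix (scalarSeries κ n f)) =
      scalarSeries₂ κ n (PowerSeries.map PowerSeries.C f) := by
  have hm : PowerSeries.map PowerSeries.C (PowerSeries.map κ f) =
      PowerSeries.map (PowerSeries.map κ) (PowerSeries.map PowerSeries.C f) := by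
    ext r : 1; simp
  ext p q : 2
  simp only [scalarSeries, scalarSeries₂, RingHom.comp_apply, mapMatrix_scalar, hm]
  obtain ⟨i, k⟩ := p
  obtain ⟨j, m⟩ := q
  by_cases h : i = j <;> by_cases h' : k = m <;> simp [inSnd_apply, h, h']

/-- The matrix `∑ E_{ij} ⊗ e_{ji}` over series in two variables. -/
noncomputable def unitMatrix₂ (e : Fin n → Fin n → S) : Matrix (Fin n) (Fin n) S⟦X⟧⟦X⟧ :=
  (PowerSeries.C (R := S⟦X⟧)).mapMatrix (unitMatrix e)

lemma unitMatrix₂_apply (i j : Fin n) :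
    unitMatrix₂ e i j = PowerSeries.C (PowerSeries.C (e j i)) := rfl

lemma unitMatrix₂_eq :
    (PowerSeries.map (PowerSeries.C (R := S))).mapMatrix (unitMatrix e) = unitMatrix₂ e := by
  ext i j : 2
  simp [unitMatrix₂, unitMatrix]

/-- Together with its companion below, this says that the two embedded copies of `unitMatrix₂ e`
multiply like the transpositions $(10)$ and $(20)$, as the Yang–Baxter lemmas require. -/
lemma inFst_mul_inSnd_unitMatrix₂
    (he : ∀ i j k m, e i j * e k m = if j = k then e i m else 0) :
    inFst _ n (unitMatrix₂ e) * inSnd _ n (unitMatrix₂ e) =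
      flipMatrix _ n * inFst _ n (unitMatrix₂ e) := by
  ext ⟨i, k⟩ ⟨j, m⟩ : 2
  rw [inFst_mul_inSnd_apply, flipMatrix_mul_apply]
  by_cases h : i = m
  · simp [unitMatrix₂_apply, ← map_mul, he, h, inFst_apply]
  · simp [unitMatrix₂_apply, ← map_mul, he, h, inFst_apply]

lemma inSnd_mul_inFst_unitMatrix₂
    (he : ∀ i j k m, e i j * e k m = if j = k then e i m else 0) :
    inSnd _ n (unitMatrix₂ e) * inFst _ n (unitMatrix₂ e) =
      flipMatrix _ n * inSnd _ n (unitMatrix₂ e) := by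
  ext ⟨i, k⟩ ⟨j, m⟩ : 2
  rw [inSnd_mul_inFst_apply, flipMatrix_mul_apply]
  by_cases h : k = j
  · simp [unitMatrix₂_apply, ← map_mul, he, h, inSnd_apply]
  · simp [unitMatrix₂_apply, ← map_mul, he, h, inSnd_apply]

lemma scalarSeries₂_xvar : scalarSeries₂ κ n (xvar K) = Matrix.scalar _ (xvar S) := by
  simp only [scalarSeries₂, RingHom.comp_apply, map_xvar]

lemma scalarSeries₂_yvar : scalarSeries₂ κ n (yvar K) = Matrix.scalar _ (yvar S) := by
  simp only [scalarSeries₂, RingHom.comp_apply, map_yvar]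

lemma shiftInv_fst (a : K) : (PowerSeries.C (shiftInv a)) *
    (1 - PowerSeries.C (PowerSeries.C a) * xvar K) = xvar K := by
  have := congrArg (PowerSeries.C (R := K⟦X⟧)) (shiftInv_mul a)
  simpa only [xvar, map_mul, map_sub, map_one] using this

lemma shiftInv_snd (a : K) : (PowerSeries.map PowerSeries.C (shiftInv a)) *
    (1 - PowerSeries.C (PowerSeries.C a) * yvar K) = yvar K := by
  have := congrArg (PowerSeries.map (PowerSeries.C (R := K))) (shiftInv_mul a)
  simpa only [yvar, map_mul, map_sub, map_one, PowerSeries.map_C, PowerSeries.map_X] using this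

lemma dressed_reflection_equation (hκ : ∀ k s, Commute (κ k) s)
    (he : ∀ i j k m, e i j * e k m = if j = k then e i m else 0)
    (h1 : ∑ i, e i i = 1) (hc : ∀ i j k m r, Commute (b i j r) (e k m))
    (hb : reflLHS b = reflRHS b) :
    reflLHS (dressed κ a e b) = reflRHS (dressed κ a e b) := by
  have hcent : ∀ z A, Commute (scalarSeries₂ κ n z) A := fun z A =>
    commute_scalar (fun s => commute_map (commute_map hκ) z s) A
  -- Scalar series in both variables act through central matrices, so the abstract dressing lemma
  -- applies with this commutative coefficient ring.
  let _ : Algebra K⟦X⟧⟦X⟧ (Matrix (Fin n × Fin n) (Fin n × Fin n) S⟦X⟧⟦X⟧) :=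
    (scalarSeries₂ κ n).toAlgebra' hcent
  have hsm : ∀ (z : K⟦X⟧⟦X⟧) (A : Matrix (Fin n × Fin n) (Fin n × Fin n) S⟦X⟧⟦X⟧),
    z • A = scalarSeries₂ κ n z * A := fun z A => rfl
  have hp : unitMatrix₂ e * unitMatrix₂ e = 1 := by
    rw [unitMatrix₂, ← map_mul, unitMatrix_mul_self he h1, map_one]
  have hR : RMinus S n = (yvar K - xvar K) • 1 - (xvar K * yvar K) • flipMatrix _ n := by
    simp only [hsm, RMinus_eq, map_sub, map_mul, scalarSeries₂_xvar, scalarSeries₂_yvar, mul_one]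
  have hR' : RPlus S n = (yvar K + xvar K) • 1 - (xvar K * yvar K) • flipMatrix _ n := by
    simp only [hsm, RPlus_eq, map_add, map_mul, scalarSeries₂_xvar, scalarSeries₂_yvar, mul_one]
  have hB1 : matB1 (dressed κ a e b) =
      (1 - (PowerSeries.C (shiftInv a) : K⟦X⟧⟦X⟧) • inFst _ n (unitMatrix₂ e)) * matB1 b *
      ((PowerSeries.C (dressScalar a) : K⟦X⟧⟦X⟧) •
        (1 - (PowerSeries.C (shiftInv (-a)) : K⟦X⟧⟦X⟧) • inFst _ n (unitMatrix₂ e))) := by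
    simp only [hsm, matB1_eq, bSeries_dressed, dressedMatrix, map_mul, map_sub, map_one,
      ← inFst_scalarSeries]
    rfl
  have hB2 : matB2 (dressed κ a e b) =
      (1 - (PowerSeries.map PowerSeries.C (shiftInv a) : K⟦X⟧⟦X⟧) • inSnd _ n (unitMatrix₂ e)) *
        matB2 b * ((PowerSeries.map PowerSeries.C (dressScalar a) : K⟦X⟧⟦X⟧) •
        (1 - (PowerSeries.map PowerSeries.C (shiftInv (-a)) : K⟦X⟧⟦X⟧) •
          inSnd _ n (unitMatrix₂ e))) := by
    simp only [hsm, matB2_eq, bSeries_dressed, dressedMatrix, map_mul, map_sub, map_one,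
      ← inSnd_scalarSeries, unitMatrix₂_eq]
  have hcs : ∀ (f : S⟦X⟧) i j, (∀ r, Commute (PowerSeries.coeff r f) (e j i)) →
      Commute f (PowerSeries.C (e j i)) := by
    intro f i j h
    ext r
    simpa using (h r).eq
  have c1 : Commute (matB1 b) (inSnd _ n (unitMatrix₂ e)) := by
    rw [matB1_eq]
    refine commute_inFst_inSnd fun i j k m => ?_
    rw [unitMatrix₂_apply]
    refine Commute.map (hcs _ _ _ fun r => ?_) PowerSeries.C
    simpa [bSeries] using hc _ _ _ _ _
  have c2 : Commute (matB2 b) (inFst _ n (unitMatrix₂ e)) := by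
    rw [matB2_eq]
    refine (commute_inFst_inSnd fun i j k m => ?_).symm
    rw [unitMatrix₂_apply]
    refine Commute.symm ?_
    ext r : 1
    simpa [bSeries, ← map_mul] using congrArg PowerSeries.C (hc k m j i r).eq
  have u := shiftInv_fst a
  have u' := shiftInv_fst (-a)
  have v := shiftInv_snd a
  have v' := shiftInv_snd (-a)
  simp only [map_neg] at u' v'
  unfold reflLHS reflRHS at hb ⊢
  rw [hR, hR'] at hb ⊢
  rw [hB1, hB2]
  refine dressed_reflection flipMatrix_mul_self (by rw [← map_mul, hp, map_one])
    (by rw [← map_mul, hp, map_one]) (flipMatrix_mul_inFst _) (flipMatrix_mul_inSnd _)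
    (inFst_mul_inSnd_unitMatrix₂ he) (inSnd_mul_inFst_unitMatrix₂ he) c1 c2 hb ?_ ?_ ?_ ?_
  -- The four scalar conditions are the denominator-free forms of $(u-a)-(v-a)=u-v$,
  -- $(u+a)-(v+a)=u-v$, $(u+a)+(v-a)=u+v$ and $(u-a)+(v+a)=u+v$.
  · linear_combination (-(yvar K * PowerSeries.map PowerSeries.C (shiftInv a))) * u +
      (xvar K * PowerSeries.C (shiftInv a)) * v
  · linear_combination (-(yvar K * PowerSeries.map PowerSeries.C (shiftInv (-a)))) * u' +
      (xvar K * PowerSeries.C (shiftInv (-a))) * v'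
  · linear_combination (-(yvar K * PowerSeries.map PowerSeries.C (shiftInv a))) * u' -
      (xvar K * PowerSeries.C (shiftInv (-a))) * v
  · linear_combination (-(yvar K * PowerSeries.map PowerSeries.C (shiftInv (-a)))) * u -
      (xvar K * PowerSeries.C (shiftInv a)) * v'

lemma IsReflectionFamily.dressed (hκ : ∀ k s, Commute (κ k) s)
    (he : ∀ i j k m, e i j * e k m = if j = k then e i m else 0)
    (h1 : ∑ i, e i i = 1) (hc : ∀ i j k m r, Commute (b i j r) (e k m))
    (hb : IsReflectionFamily b) : IsReflectionFamily (dressed κ a e b) :=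
  ⟨dressed_reflection_equation hκ he h1 hc hb.1, dressed_unitary hκ he h1 hb.2⟩

end Dressing

end ReflAlg

/-! ### Ring filtrations and the commutator estimate -/

namespace ReflAlg

open scoped Kronecker PowerSeries

/-- An increasing filtration of a ring by additive subgroups indexed by `ℤ`. -/
structure RingFiltration (A : Type*) [Ring A] where
  /-- The terms of the filtration. -/
  piece : ℤ → AddSubgroup A
  mono : Monotone piece
  one_mem : 1 ∈ piece 0
  mul_mem : ∀ {i j : ℤ} {a b : A}, a ∈ piece i → b ∈ piece j → a * b ∈ piece (i + j)

namespace RingFiltration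

variable {A : Type*} [Ring A] (F : RingFiltration A)

lemma mem_of_le {i j : ℤ} (h : i ≤ j) {a : A} (ha : a ∈ F.piece i) : a ∈ F.piece j :=
  F.mono h ha

lemma mul_mem_of_le {i j k : ℤ} (h : i + j ≤ k) {a b : A} (ha : a ∈ F.piece i)
    (hb : b ∈ F.piece j) : a * b ∈ F.piece k :=
  F.mem_of_le h (F.mul_mem ha hb)

/-- The filtration of `A[X]` where `X` has degree `k`. -/
noncomputable def polynomial (k : ℤ) : RingFiltration (Polynomial A) where
  piece m :=
    { carrier := {f | ∀ p : ℕ, f.coeff p ∈ F.piece (m - k * p)}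
      zero_mem' := fun p => by simp [zero_mem]
      add_mem' := fun hf hg p => by simpa using add_mem (hf p) (hg p)
      neg_mem' := fun hf p => by simpa using hf p }
  mono := fun i j h f hf p => F.mem_of_le (by linarith) (hf p)
  one_mem := fun p => by
    rcases p with _ | p
    · simpa using F.one_mem
    · simp [Polynomial.coeff_one, zero_mem]
  mul_mem := fun {i j f g} hf hg p => by
    rw [Polynomial.coeff_mul]
    refine sum_mem fun x hx => F.mul_mem_of_le (le_of_eq ?_) (hf x.1) (hg x.2)
    rw [← Finset.HasAntidiagonal.mem_antidiagonal.1 hx]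
    push_cast
    ring

/-- The filtration of `A⟦X⟧` where `X` has degree `-k`. -/
noncomputable def powerSeries (k : ℤ) : RingFiltration A⟦X⟧ where
  piece m :=
    { carrier := {f | ∀ p : ℕ, PowerSeries.coeff p f ∈ F.piece (m + k * p)}
      zero_mem' := fun p => by simp [zero_mem]
      add_mem' := fun hf hg p => by simpa using add_mem (hf p) (hg p)
      neg_mem' := fun hf p => by simpa using hf p }
  mono := fun i j h f hf p => F.mem_of_le (by linarith) (hf p)
  one_mem := fun p => by
    rcases p with _ | p
    · simpa using F.one_mem
    · simp [PowerSeries.coeff_one, zero_mem]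
  mul_mem := fun {i j f g} hf hg p => by
    rw [PowerSeries.coeff_mul]
    refine sum_mem fun x hx => F.mul_mem_of_le (le_of_eq ?_) (hf x.1) (hg x.2)
    rw [← Finset.HasAntidiagonal.mem_antidiagonal.1 hx]
    push_cast
    ring

/-- The filtration of a matrix ring by entries. -/
noncomputable def matrix (ι : Type*) [Fintype ι] [DecidableEq ι] :
    RingFiltration (Matrix ι ι A) where
  piece m :=
    { carrier := {M | ∀ i j, M i j ∈ F.piece m}
      zero_mem' := fun i j => by simp [zero_mem]
      add_mem' := fun hf hg i j => add_mem (hf i j) (hg i j)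
      neg_mem' := fun hf i j => neg_mem (hf i j) }
  mono := fun i j h f hf p q => F.mem_of_le h (hf p q)
  one_mem := fun i j => by
    by_cases h : i = j
    · subst h
      simpa using F.one_mem
    · simp [h, zero_mem]
  mul_mem := fun {i j f g} hf hg p q => by
    rw [Matrix.mul_apply]
    exact sum_mem fun x _ => F.mul_mem (hf _ _) (hg _ _)

lemma scalar_mem {ι : Type*} [Fintype ι] [DecidableEq ι] {m : ℤ} {a : A} (h : a ∈ F.piece m) :
    Matrix.scalar ι a ∈ (F.matrix ι).piece m := fun i j => by
  by_cases hij : i = j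
  · simpa [hij] using h
  · simp [hij, zero_mem]

lemma C_mem {k m : ℤ} {a : A} (h : a ∈ F.piece m) :
    PowerSeries.C a ∈ (F.powerSeries k).piece m := fun p => by
  rcases p with _ | p
  · simpa using h
  · simp [zero_mem]

lemma polynomial_C_mem {k m : ℤ} {a : A} (h : a ∈ F.piece m) :
    Polynomial.C a ∈ (F.polynomial k).piece m := fun p => by
  rcases p with _ | p
  · simpa using h
  · simp [zero_mem]

lemma X_mem {k : ℤ} : (PowerSeries.X : A⟦X⟧) ∈ (F.powerSeries k).piece (-k) := fun p => by
  by_cases h : p = 1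
  · subst h
    simpa using F.one_mem
  · simp [PowerSeries.coeff_X, h, zero_mem]

/-- A solution of `s = 1 + w s` has degree zero if `w` has degree zero and no constant term. -/
lemma geometric_mem {k : ℤ} {w s : A⟦X⟧} (hw : w ∈ (F.powerSeries k).piece 0)
    (hw0 : PowerSeries.coeff 0 w = 0) (hs : s = 1 + w * s) : s ∈ (F.powerSeries k).piece 0 := by
  intro p
  induction p using Nat.strong_induction_on with
  | _ p ih =>
    rw [hs, map_add, PowerSeries.coeff_mul]
    refine add_mem ((F.powerSeries k).one_mem p) (sum_mem fun x hx => ?_)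
    have hx' := Finset.HasAntidiagonal.mem_antidiagonal.1 hx
    -- Since $w$ has no constant term, the coefficient of $ws$ in degree $p$ involves only earlier
    -- coefficients of $s$.
    rcases Nat.eq_zero_or_pos x.1 with h | h
    · simp [h, hw0, zero_mem]
    · refine F.mul_mem_of_le (le_of_eq ?_) (hw x.1) (ih x.2 (by omega))
      rw [← hx']
      push_cast
      ring

lemma inFst_mem {n : ℕ} {m : ℤ} {M : Matrix (Fin n) (Fin n) A}
    (h : M ∈ (F.matrix (Fin n)).piece m) :
    inFst A n M ∈ (F.matrix (Fin n × Fin n)).piece m := fun p q => by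
  rw [inFst_apply]
  split_ifs
  · exact h _ _
  · exact zero_mem _

lemma inSnd_mem {n : ℕ} {m : ℤ} {M : Matrix (Fin n) (Fin n) A}
    (h : M ∈ (F.matrix (Fin n)).piece m) :
    inSnd A n M ∈ (F.matrix (Fin n × Fin n)).piece m := fun p q => by
  rw [inSnd_apply]
  split_ifs
  · exact h _ _
  · exact zero_mem _

lemma flipMatrix_mem {n : ℕ} : flipMatrix A n ∈ (F.matrix (Fin n × Fin n)).piece 0 := fun p q => by
  simp only [flipMatrix, Matrix.of_apply]
  split_ifs
  · exact F.one_mem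
  · exact zero_mem _

/-- Commutators of the coefficients of a solution of the reflection equation drop in degree. -/
lemma commutator_mem {n : ℕ} {k : ℤ} (hk : 0 ≤ k) {b : Fin n → Fin n → ℕ → A}
    (hb : reflLHS b = reflRHS b)
    (hF : ∀ i j (r : ℕ), b i j r ∈ F.piece (k * r)) (i j i' j' : Fin n) (r s : ℕ) :
    b i j r * b i' j' s - b i' j' s * b i j r ∈ F.piece (k * (r + s) - k) := by
  set G := (F.powerSeries k).powerSeries k with hG
  set H := G.matrix (Fin n × Fin n) with hH
  have hx : xvar A ∈ G.piece (-k) := (F.powerSeries k).C_mem F.X_mem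
  have hy : yvar A ∈ G.piece (-k) := (F.powerSeries k).X_mem
  have hB1 : matB1 b ∈ H.piece 0 := by
    rw [matB1_eq]
    refine G.inFst_mem fun i j => (F.powerSeries k).C_mem fun r => ?_
    simpa [bSeries] using hF i j r
  have hB2 : matB2 b ∈ H.piece 0 := by
    rw [matB2_eq]
    refine G.inSnd_mem fun i j r => ?_
    simpa [bSeries] using F.C_mem (by simpa using hF i j r)
  have hP : flipMatrix _ n ∈ H.piece 0 := G.flipMatrix_mem
  have hd := G.scalar_mem (ι := Fin n × Fin n) (sub_mem hy hx)
  have he := G.scalar_mem (ι := Fin n × Fin n) (add_mem hy hx)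
  have hq := G.scalar_mem (ι := Fin n × Fin n) (G.mul_mem hx hy)
  have hxc : ∀ f, Commute (xvar A) f := fun f => by
    unfold xvar
    ext r : 1
    simpa using (PowerSeries.commute_X _).symm.eq
  have hyc : ∀ f, Commute (yvar A) f := fun f => (PowerSeries.commute_X f).symm
  have hqP := H.mul_mem hq hP
  -- The scalars $y\pm x$ have degree $-k$ and $xyP$ has degree $-2k$. Every term of the expanded
  -- equation that contains $P$ thus has degree at most $-3k$.
  have key : Matrix.scalar _ (yvar A - xvar A) * matB1 b * Matrix.scalar _ (yvar A + xvar A) *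
      matB2 b - matB2 b * Matrix.scalar _ (yvar A + xvar A) * matB1 b *
      Matrix.scalar _ (yvar A - xvar A) ∈ H.piece (-(3 * k)) := by
    unfold reflLHS reflRHS at hb
    rw [RMinus_eq, RPlus_eq] at hb
    generalize Matrix.scalar (Fin n × Fin n) (yvar A - xvar A) = d at *
    generalize Matrix.scalar (Fin n × Fin n) (yvar A + xvar A) = e at *
    generalize Matrix.scalar (Fin n × Fin n) (xvar A * yvar A) * flipMatrix A⟦X⟧⟦X⟧ n = q at *
    generalize matB1 b = B₁ at *
    generalize matB2 b = B₂ at *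
    have e1 : d * B₁ * e * B₂ - B₂ * e * B₁ * d =
        (d * B₁ * q * B₂ + q * B₁ * e * B₂ - q * B₁ * q * B₂) -
          (B₂ * e * B₁ * q + B₂ * q * B₁ * d - B₂ * q * B₁ * q) := by
      have := sub_eq_zero.2 hb
      rw [← sub_eq_zero, ← this]
      noncomm_ring
    rw [e1]
    have t4 : ∀ {u v w z : Matrix (Fin n × Fin n) (Fin n × Fin n) A⟦X⟧⟦X⟧} {i j l m : ℤ},
        u ∈ H.piece i → v ∈ H.piece j → w ∈ H.piece l → z ∈ H.piece m →
        i + j + l + m ≤ -(3 * k) → u * v * w * z ∈ H.piece (-(3 * k)) :=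
      fun h1 h2 h3 h4 h => H.mul_mem_of_le h (H.mul_mem (H.mul_mem h1 h2) h3) h4
    refine sub_mem (sub_mem (add_mem ?_ ?_) ?_) (sub_mem (add_mem ?_ ?_) ?_)
    · exact t4 hd hB1 hqP hB2 (by linarith)
    · exact t4 hqP hB1 he hB2 (by linarith)
    · exact t4 hqP hB1 hqP hB2 (by linarith)
    · exact t4 hB2 he hB1 hqP (by linarith)
    · exact t4 hB2 hqP hB1 hd (by linarith)
    · exact t4 hB2 hqP hB1 hqP (by linarith)
  have key' : Matrix.scalar _ (yvar A * yvar A - xvar A * xvar A) *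
      (matB1 b * matB2 b - matB2 b * matB1 b) ∈ H.piece (-(3 * k)) := by
    have c1 := commute_scalar (m := Fin n × Fin n) (fun s => (hyc s).sub_left (hxc s))
    have c2 := commute_scalar (m := Fin n × Fin n) (fun s => (hyc s).add_left (hxc s))
    convert key using 1
    have : yvar A * yvar A - xvar A * xvar A = (yvar A - xvar A) * (yvar A + xvar A) :=
      (hyc (xvar A)).mul_self_sub_mul_self_eq'
    rw [this, map_mul]
    generalize Matrix.scalar (Fin n × Fin n) (yvar A - xvar A) = d at *
    generalize Matrix.scalar (Fin n × Fin n) (yvar A + xvar A) = e at *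
    have a1 : d * matB1 b * e * matB2 b = d * e * (matB1 b * matB2 b) := by
      rw [mul_assoc d, ← (c2 (matB1 b)).eq]
      simp only [mul_assoc]
    have a2 : matB2 b * e * matB1 b * d = d * e * (matB2 b * matB1 b) := by
      rw [← (c1 (matB2 b * e * matB1 b)).eq, ← (c2 (matB2 b)).eq]
      simp only [mul_assoc]
    rw [a1, a2, mul_sub]
  have hent := key' (i, i') (j, j')
  rw [Matrix.scalar_apply, Matrix.diagonal_mul, Matrix.sub_apply, matB1_eq, matB2_eq,
    inFst_mul_inSnd_apply, inSnd_mul_inFst_apply] at hent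
  set f : A⟦X⟧⟦X⟧ := (PowerSeries.C).mapMatrix (bSeries b) i j *
    (PowerSeries.map PowerSeries.C).mapMatrix (bSeries b) i' j' -
    (PowerSeries.map PowerSeries.C).mapMatrix (bSeries b) i' j' *
    (PowerSeries.C).mapMatrix (bSeries b) i j with hf
  have hcoef : ∀ r s, PowerSeries.coeff r (PowerSeries.coeff s f) =
      b i j r * b i' j' s - b i' j' s * b i j r := by
    intro r s
    simp [hf, bSeries]
  -- At the coefficient of $x^r y^{s+2}$, the term $y^2f$ contributes the commutator with indices
  -- $(r,s)$, and $x^2f$ the one with $(r-2,s+2)$, absent for $r<2$. The sum of the indices is the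
  -- same, so induction on $r$ closes with one bound.
  have hrec : ∀ r s : ℕ, PowerSeries.coeff r (PowerSeries.coeff (s + 2) ((yvar A * yvar A -
      xvar A * xvar A) * f)) ∈ F.piece (k * (r + s) - k) := by
    intro r s
    refine F.mem_of_le (le_of_eq ?_) (hent (s + 2) r)
    push_cast
    ring
  have hyy : ∀ s, PowerSeries.coeff (s + 2) (yvar A * yvar A * f) = PowerSeries.coeff s f := by
    intro s
    rw [mul_assoc, yvar, PowerSeries.coeff_succ_X_mul, PowerSeries.coeff_succ_X_mul]
  have hxx : ∀ s, PowerSeries.coeff s (xvar A * xvar A * f) =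
      PowerSeries.X * (PowerSeries.X * PowerSeries.coeff s f) := by
    intro s
    rw [mul_assoc, xvar, PowerSeries.coeff_C_mul, PowerSeries.coeff_C_mul]
  simp only [sub_mul, map_sub, hyy, hxx] at hrec
  induction r using Nat.strong_induction_on generalizing s with
  | _ r ih =>
    rcases r with _ | _ | r
    · simpa [hcoef] using hrec 0 s
    · simpa [hcoef, PowerSeries.coeff_one_mul, PowerSeries.coeff_succ_X_mul] using hrec 1 s
    · have h1 := hrec (r + 2) s
      have h2 := ih r (by omega) (s + 2)
      rw [PowerSeries.coeff_succ_X_mul, PowerSeries.coeff_succ_X_mul, hcoef, hcoef] at h1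
      have h3 := add_mem h1 (F.mem_of_le (j := k * ((r + 2 : ℕ) + s) - k) (le_of_eq ?_) h2)
      · rw [sub_add_cancel] at h3
        exact h3
      · push_cast
        ring

end RingFiltration
end ReflAlg

namespace ReflAlg

/-! ### Spans of words by weight, and sorted words as a spanning set -/

section Words

variable {k A ι : Type*} [Field k] [Ring A] [Algebra k A] (g : ι → A) (ω : ι → ℕ)

/-- The span of all words of weight at most `m` in the elements `g i`, where `g i` has weight
`ω i`. -/
noncomputable def wordSpan (k : Type*) {A ι : Type*} [Field k] [Ring A] [Algebra k A] (g : ι → A)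
    (ω : ι → ℕ) (m : ℤ) : Submodule k A :=
  Submodule.span k {a | ∃ L : List ι, ((L.map ω).sum : ℤ) ≤ m ∧ (L.map g).prod = a}

lemma wordSpan_mono : Monotone (wordSpan k g ω) := fun _ _ h =>
  Submodule.span_mono fun _ ⟨L, hL, e⟩ => ⟨L, hL.trans h, e⟩

lemma word_mem_wordSpan {L : List ι} {m : ℤ} (h : ((L.map ω).sum : ℤ) ≤ m) :
    (L.map g).prod ∈ wordSpan k g ω m :=
  Submodule.subset_span ⟨L, h, rfl⟩

lemma gen_mem_wordSpan (i : ι) : g i ∈ wordSpan k g ω (ω i) := by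
  simpa using word_mem_wordSpan (k := k) g ω (L := [i]) (m := ω i) (by simp)

lemma mul_mem_wordSpan {i j : ℤ} {a b : A} (ha : a ∈ wordSpan k g ω i)
    (hb : b ∈ wordSpan k g ω j) : a * b ∈ wordSpan k g ω (i + j) := by
  have h := Submodule.mul_mem_mul ha hb
  rw [wordSpan, wordSpan, Submodule.span_mul_span] at h
  refine Submodule.span_mono ?_ h
  rintro _ ⟨_, ⟨L, hL, rfl⟩, _, ⟨M, hM, rfl⟩, rfl⟩
  refine ⟨L ++ M, ?_, by simp⟩
  rw [List.map_append, List.sum_append, Nat.cast_add]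
  exact add_le_add hL hM

/-- The filtration of an algebra by the weight of words in a family of elements. -/
noncomputable def wordFiltration (k : Type*) {A ι : Type*} [Field k] [Ring A] [Algebra k A]
    (g : ι → A) (ω : ι → ℕ) : RingFiltration A where
  piece m := (wordSpan k g ω m).toAddSubgroup
  mono := fun _ _ h => wordSpan_mono g ω h
  one_mem := word_mem_wordSpan g ω (L := []) (by simp)
  mul_mem := mul_mem_wordSpan g ω

lemma wordSpan_of_neg {m : ℤ} (hm : m < 0) : wordSpan k g ω m = ⊥ := by
  rw [wordSpan, Submodule.span_eq_bot]
  rintro _ ⟨L, hL, _⟩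
  omega

variable {g ω}

/-- If commutators of generators drop in weight, reordering a word changes it by lower terms. -/
lemma word_sub_word_mem
    (hcomm : ∀ i j, g i * g j - g j * g i ∈ wordSpan k g ω ((ω i : ℤ) + ω j - 1))
    {L M : List ι} (h : L.Perm M) :
    (L.map g).prod - (M.map g).prod ∈ wordSpan k g ω (((L.map ω).sum : ℤ) - 1) := by
  induction h with
  | nil => simp [zero_mem]
  | cons x _ ih =>
    have := mul_mem_wordSpan g ω (gen_mem_wordSpan (k := k) g ω x) ih
    rw [mul_sub] at this
    simp only [List.map_cons, List.sum_cons, List.prod_cons]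
    refine wordSpan_mono g ω (le_of_eq ?_) this
    rw [Nat.cast_add]
    ring
  | swap x y L =>
    have := mul_mem_wordSpan g ω (hcomm y x) (word_mem_wordSpan (k := k) g ω (L := L) le_rfl)
    rw [sub_mul, mul_assoc, mul_assoc] at this
    simp only [List.map_cons, List.sum_cons, List.prod_cons]
    refine wordSpan_mono g ω (le_of_eq ?_) this
    rw [Nat.cast_add, Nat.cast_add]
    ring
  | trans h₁ h₂ ih₁ ih₂ =>
    rw [← (h₁.map ω).sum_eq] at ih₂
    simpa using add_mem ih₁ ih₂

/-- Sorted words in a subfamily span, if commutators of generators drop in weight and the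
generators outside of the subfamily are combinations of words of smaller weight. -/
lemma wordSpan_le_span_sorted {J : Type*} [LinearOrder J] (good : J → ι)
    (hcomm : ∀ i j, g i * g j - g j * g i ∈ wordSpan k g ω ((ω i : ℤ) + ω j - 1))
    (hbad : ∀ i, i ∉ Set.range good → g i ∈ wordSpan k g ω ((ω i : ℤ) - 1)) (m : ℕ) :
    wordSpan k g ω ((m : ℤ) - 1) ≤ Submodule.span k (Set.range
      fun L : {L : List J // L.Pairwise (fun x y => x ≤ y)} => (L.1.map (g ∘ good)).prod) := by
  -- The bound $m-1$ makes the base case the zero space of negative weight; the step treats words of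
  -- weight exactly $m$.
  induction m with
  | zero => rw [wordSpan_of_neg g ω (by simp)]; exact bot_le
  | succ m ih =>
    rw [wordSpan, Submodule.span_le]
    rintro _ ⟨L, hL, rfl⟩
    push_cast at hL
    rcases lt_or_eq_of_le hL with hlt | heq
    · exact ih (word_mem_wordSpan g ω (by push_cast; omega))
    have hsum : ((L.map ω).sum : ℤ) = m := by push_cast; omega
    by_cases hg : ∀ x ∈ L, x ∈ Set.range good
    · have : L ∈ Set.range (List.map good) := by
        rw [Set.range_list_map]; exact hg
      obtain ⟨L, rfl⟩ := this
      have hp := (List.perm_insertionSort (· ≤ ·) L).symm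
      have h1 := ih (hsum ▸ word_sub_word_mem hcomm (hp.map good))
      have h2 : ((L.insertionSort (· ≤ ·)).map (g ∘ good)).prod ∈ Submodule.span k (Set.range
          fun L : {L : List J // L.Pairwise (fun x y => x ≤ y)} =>
            (L.1.map (g ∘ good)).prod) :=
        Submodule.subset_span ⟨⟨_, List.pairwise_insertionSort (· ≤ ·) L⟩, rfl⟩
      rw [List.map_map, List.map_map] at h1
      rw [List.map_map]
      simpa using add_mem h1 h2
    -- A letter outside the good family is a combination of words of smaller weight, and
    -- substituting it lowers the weight of the whole word.
    · push Not at hg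
      obtain ⟨x, hx, hbx⟩ := hg
      obtain ⟨M, N, rfl⟩ := List.append_of_mem hx
      refine ih ?_
      have := mul_mem_wordSpan g ω (word_mem_wordSpan (k := k) g ω (L := M) le_rfl)
        (mul_mem_wordSpan g ω (hbad x hbx) (word_mem_wordSpan (k := k) g ω (L := N) le_rfl))
      simp only [List.map_append, List.map_cons, List.prod_append, List.prod_cons]
      convert this using 2
      rw [← hsum]
      simp only [List.map_append, List.map_cons, List.sum_append, List.sum_cons]
      push_cast
      ring

end Words

/-! ### Deleting a letter, the combinatorics of a derivative of a word -/

section Deletions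

variable {J : Type*} [DecidableEq J]

/-- The lists obtained by deleting one occurrence of `h`, with multiplicity. -/
def deletions (h : J) : List J → List (List J)
  | [] => []
  | x :: L => (if x = h then [L] else []) ++ (deletions h L).map (x :: ·)

lemma perm_of_mem_deletions {h : J} : ∀ {L M : List J}, M ∈ deletions h L → L.Perm (h :: M)
  | [], M, hM => by simp [deletions] at hM
  | x :: L, M, hM => by
    rw [deletions, List.mem_append] at hM
    rcases hM with hM | hM
    · split_ifs at hM with hx
      · rw [List.mem_singleton] at hM
        rw [hM, hx]
      · simp at hM
    · obtain ⟨N, hN, rfl⟩ := List.mem_map.1 hM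
      exact ((perm_of_mem_deletions hN).cons x).trans (List.Perm.swap _ _ _)

lemma length_deletions (h : J) : ∀ L : List J, (deletions h L).length = L.count h
  | [] => rfl
  | x :: L => by
    rw [deletions, List.length_append, List.length_map, length_deletions h L, List.count_cons]
    by_cases hx : x = h <;> simp [hx, add_comm]

end Deletions

/-! ### Operators that are derivations up to lower weight -/

section Derivations

variable {J k A ι : Type*} [Field k] [Ring A] [Algebra k A] {g : ι → A} {ω : ι → ℕ}

/-- Composition of a list of operators followed by a functional. -/
def iterFunctional (D : J → A →ₗ[k] A) (φ : A →ₗ[k] k) : List J → A →ₗ[k] k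
  | [] => φ
  | h :: t => iterFunctional D φ t ∘ₗ D h

variable {good : J → ι} {D : J → A →ₗ[k] A} {φ : A →ₗ[k] k} {c : J → k}

/-- Each operator lowers the weight by that of its letter, so the last argument has negative weight
and is zero. -/
lemma iterFunctional_eq_zero
    (hD : ∀ h m x, x ∈ wordSpan k g ω m → D h x ∈ wordSpan k g ω (m - ω (good h))) :
    ∀ (t : List J) {x : A}, x ∈ wordSpan k g ω ((((t.map (ω ∘ good)).sum : ℕ) : ℤ) - 1) →
      iterFunctional D φ t x = 0
  | [], x, hx => by
    rw [wordSpan_of_neg g ω (by simp)] at hx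
    rw [(Submodule.mem_bot k).1 hx, map_zero]
  | h :: t, x, hx => by
    refine iterFunctional_eq_zero hD t ?_
    convert hD h _ _ hx using 2
    simp only [List.map_cons, List.sum_cons, Function.comp_apply]
    push_cast
    ring

variable [DecidableEq J]

/-- Iterating the approximate Leibniz rule leaves one deletion for each occurrence of $h$; the
accumulated defects are one step lower in weight. -/
lemma deriv_word_sub_mem
    (hleib : ∀ h i j x y, x ∈ wordSpan k g ω i → y ∈ wordSpan k g ω j →
      D h (x * y) - (D h x * y + x * D h y) ∈ wordSpan k g ω (i + j - ω (good h) - 1))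
    (hone : ∀ h, D h 1 = 0)
    (hgen : ∀ h x, D h (g (good x)) - (if x = h then algebraMap k A (c h) else 0) ∈
      wordSpan k g ω ((ω (good x) : ℤ) - ω (good h) - 1)) (h : J) :
    ∀ L : List J, D h (L.map (g ∘ good)).prod -
      c h • ((deletions h L).map fun M => (M.map (g ∘ good)).prod).sum ∈
        wordSpan k g ω ((((L.map (ω ∘ good)).sum : ℕ) : ℤ) - ω (good h) - 1)
  | [] => by simp [deletions, hone, zero_mem]
  | x :: L => by
    have hw : (L.map (g ∘ good)).prod ∈ wordSpan k g ω ((L.map (ω ∘ good)).sum : ℕ) := by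
      have := word_mem_wordSpan (k := k) g ω (L := L.map good) le_rfl
      simpa only [List.map_map] using this
    have hx := gen_mem_wordSpan (k := k) g ω (good x)
    have e1 := hleib h _ _ _ _ hx hw
    have e2 := mul_mem_wordSpan g ω (hgen h x) hw
    have e3 := mul_mem_wordSpan g ω hx (deriv_word_sub_mem hleib hone hgen h L)
    have hsum : ((((x :: L).map (ω ∘ good)).sum : ℕ) : ℤ) =
        ω (good x) + ((L.map (ω ∘ good)).sum : ℕ) := by
      simp
    set w := ((((x :: L).map (ω ∘ good)).sum : ℕ) : ℤ) - ω (good h) - 1 with hw'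
    have key := add_mem (add_mem (wordSpan_mono g ω (b := w) (le_of_eq ?_) e1)
      (wordSpan_mono g ω (b := w) (le_of_eq ?_) e2)) (wordSpan_mono g ω (b := w) (le_of_eq ?_) e3)
    · convert key using 1
      have e4 : ((deletions h (x :: L)).map fun M => (M.map (g ∘ good)).prod).sum =
          (if x = h then (L.map (g ∘ good)).prod else 0) +
            g (good x) * ((deletions h L).map fun M => (M.map (g ∘ good)).prod).sum := by
        rw [deletions, List.map_append, List.sum_append, List.map_map,
          ← List.sum_map_mul_left]
        congr 1
        by_cases hxh : x = h <;> simp [hxh]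
      rw [e4]
      by_cases hxh : x = h
      · simp only [hxh, if_true, List.map_cons, List.prod_cons, Function.comp_apply, sub_mul,
          mul_sub, smul_add, mul_smul_comm, ← Algebra.smul_def]
        abel
      · simp only [hxh, if_false, List.map_cons, List.prod_cons, Function.comp_apply, sub_mul,
          mul_sub, smul_add, mul_smul_comm, smul_zero, zero_mul]
        abel
    all_goals linarith

/-- The value of an iterated functional on the word it corresponds to. -/
def iterValue (c : J → k) (v : k) : List J → k
  | [] => v
  | h :: t => c h * ((t.count h + 1 : ℕ) : k) * iterValue c v t

lemma iterValue_ne_zero [CharZero k] (hc : ∀ h, c h ≠ 0) {v : k} (hv : v ≠ 0) :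
    ∀ t : List J, iterValue c v t ≠ 0
  | [] => hv
  | h :: t => mul_ne_zero (mul_ne_zero (hc h) (Nat.cast_ne_zero.2 (Nat.succ_ne_zero _)))
      (iterValue_ne_zero hc hv t)

/-- At the top weight the Leibniz defects fall under `iterFunctional_eq_zero`, so the operators act
exactly as partial derivatives on commutative monomials. -/
lemma iterFunctional_word (hpos : ∀ h, 0 < ω (good h))
    (hD : ∀ h m x, x ∈ wordSpan k g ω m → D h x ∈ wordSpan k g ω (m - ω (good h)))
    (hleib : ∀ h i j x y, x ∈ wordSpan k g ω i → y ∈ wordSpan k g ω j →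
      D h (x * y) - (D h x * y + x * D h y) ∈ wordSpan k g ω (i + j - ω (good h) - 1))
    (hone : ∀ h, D h 1 = 0)
    (hgen : ∀ h x, D h (g (good x)) - (if x = h then algebraMap k A (c h) else 0) ∈
      wordSpan k g ω ((ω (good x) : ℤ) - ω (good h) - 1)) :
    ∀ t L : List J, (L.map (ω ∘ good)).sum = (t.map (ω ∘ good)).sum →
      iterFunctional D φ t (L.map (g ∘ good)).prod = if L.Perm t then iterValue c (φ 1) t else 0
  | [], L, hL => by
    rcases L with _ | ⟨x, L⟩
    · simp [iterFunctional, iterValue]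
    · have := hpos x
      simp at hL
      omega
  | h :: t, L, hL => by
    have h1 := iterFunctional_eq_zero (φ := φ) hD t (wordSpan_mono g ω (le_of_eq ?_)
      (deriv_word_sub_mem hleib hone hgen h L))
    · rw [map_sub, sub_eq_zero, map_smul, map_list_sum, List.map_map] at h1
      rw [iterFunctional, LinearMap.comp_apply, h1]
      -- All deletions of $h$ from $L$ are permutations of one another, hence have the same value;
      -- their number is the multiplicity of $h$.
      have h2 : (deletions h L).map (⇑(iterFunctional D φ t) ∘ fun M => (M.map (g ∘ good)).prod) =
          List.replicate (L.count h) (if L.Perm (h :: t) then iterValue c (φ 1) t else 0) := by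
        rw [List.eq_replicate_iff]
        refine ⟨by rw [List.length_map, length_deletions], ?_⟩
        intro y hy
        obtain ⟨M, hM, rfl⟩ := List.mem_map.1 hy
        have hp := perm_of_mem_deletions hM
        have hs : (M.map (ω ∘ good)).sum = (t.map (ω ∘ good)).sum := by
          have := (hp.map (ω ∘ good)).sum_eq
          simp only [List.map_cons, List.sum_cons] at this hL
          omega
        rw [Function.comp_apply, iterFunctional_word hpos hD hleib hone hgen t M hs]
        congr 1
        exact propext ⟨fun q => hp.trans (q.cons h), fun q => (hp.symm.trans q).cons_inv⟩
      rw [h2, List.sum_replicate]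
      split_ifs with hp
      · rw [hp.count_eq, List.count_cons_self, iterValue, nsmul_eq_mul, smul_eq_mul, mul_assoc]
      · simp
    · rw [hL]
      simp only [List.map_cons, List.sum_cons, Function.comp_apply]
      push_cast
      ring

end Derivations

/-! ### Linear independence of sorted words -/

section Independence

variable {J : Type*} [LinearOrder J] {k A ι : Type*} [Field k] [CharZero k] [Ring A] [Algebra k A]
  {g : ι → A} {ω : ι → ℕ} {good : J → ι} {D : J → A →ₗ[k] A} {φ : A →ₗ[k] k} {c : J → k}

/-- Sorted words in a family of elements are linearly independent if there are operators which act
on them, up to terms of lower weight, as the partial derivatives act on monomials. -/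
lemma linearIndependent_sorted_words (hpos : ∀ h, 0 < ω (good h))
    (hD : ∀ h m x, x ∈ wordSpan k g ω m → D h x ∈ wordSpan k g ω (m - ω (good h)))
    (hleib : ∀ h i j x y, x ∈ wordSpan k g ω i → y ∈ wordSpan k g ω j →
      D h (x * y) - (D h x * y + x * D h y) ∈ wordSpan k g ω (i + j - ω (good h) - 1))
    (hone : ∀ h, D h 1 = 0)
    (hgen : ∀ h x, D h (g (good x)) - (if x = h then algebraMap k A (c h) else 0) ∈
      wordSpan k g ω ((ω (good x) : ℤ) - ω (good h) - 1))
    (hc : ∀ h, c h ≠ 0) (hφ : φ 1 ≠ 0) :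
    LinearIndependent k fun L : {L : List J // L.Pairwise (fun x y => x ≤ y)} =>
      (L.1.map (g ∘ good)).prod := by
  rw [linearIndependent_iff]
  intro f hf
  by_contra hne
  -- By maximality, every other word in the support is lighter than $L_0$, hence killed, or equally
  -- heavy. In the second case it is also killed, because two sorted lists that are permutations of
  -- each other coincide.
  obtain ⟨L₀, hL₀, hmax⟩ := Finset.exists_max_image f.support
    (fun L => (L.1.map (ω ∘ good)).sum) (Finsupp.support_nonempty_iff.2 hne)
  have h := congrArg (iterFunctional D φ L₀.1) hf
  rw [Finsupp.linearCombination_apply, Finsupp.sum, map_sum, map_zero,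
    Finset.sum_eq_single_of_mem L₀ hL₀] at h
  · rw [map_smul, iterFunctional_word hpos hD hleib hone hgen _ _ rfl, if_pos (List.Perm.refl _),
      smul_eq_mul] at h
    rcases mul_eq_zero.1 h with h | h
    · exact Finsupp.mem_support_iff.1 hL₀ h
    · exact iterValue_ne_zero hc hφ _ h
  · intro L hL hLne
    rw [map_smul]
    rcases lt_or_eq_of_le (hmax L hL) with hlt | heq
    · rw [iterFunctional_eq_zero hD, smul_zero]
      have := word_mem_wordSpan (k := k) g ω (L := L.1.map good) le_rfl
      rw [List.map_map, List.map_map] at this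
      exact wordSpan_mono g ω (by omega) this
    · rw [iterFunctional_word hpos hD hleib hone hgen _ _ heq, if_neg, smul_zero]
      exact fun hp => hLne (Subtype.ext (hp.eq_of_pairwise' L.2 L₀.2))

end Independence
end ReflAlg

namespace ReflAlg

open scoped Kronecker PowerSeries

/-! ### First order expansion of the dressing -/

section Approximation

variable {K S : Type*} [CommRing K] [Ring S] {n : ℕ} {κ : K →+* S} {a : K}
  {e : Fin n → Fin n → S} {b : Fin n → Fin n → ℕ → S}

lemma RingFiltration.pow_mem (F : RingFiltration S) {m : ℤ} {x : S} (hx : x ∈ F.piece m) :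
    ∀ r : ℕ, x ^ r ∈ F.piece (m * r)
  | 0 => by simpa using F.one_mem
  | r + 1 => by
    rw [pow_succ]
    refine F.mul_mem_of_le (le_of_eq ?_) (F.pow_mem hx r) hx
    push_cast
    ring

lemma coeff_map_shiftInv_succ (r : ℕ) :
    PowerSeries.coeff (r + 1) (PowerSeries.map κ (shiftInv a)) = κ a ^ r := by
  simp [shiftInv]

lemma map_shiftInv_mem (F : RingFiltration S) {m : ℤ} (ha : κ a ∈ F.piece m) :
    PowerSeries.map κ (shiftInv a) ∈ (F.powerSeries m).piece (-m) := by
  intro r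
  rcases r with _ | r
  · simp [shiftInv, zero_mem]
  · rw [coeff_map_shiftInv_succ]
    refine F.mem_of_le (le_of_eq ?_) (F.pow_mem ha r)
    push_cast
    ring

lemma scalarSeries_mul_unitMatrix_apply (f : K⟦X⟧) (p q : Fin n) :
    (scalarSeries κ n f * unitMatrix e) p q = PowerSeries.map κ f * PowerSeries.C (e q p) := by
  simp [scalarSeries, unitMatrix]

/-- The first order expansion of the dressed matrix with respect to a filtration. -/
lemma dressedMatrix_approx (F : RingFiltration S) (ha : κ a ∈ F.piece 3)
    (he : ∀ i j, e i j ∈ F.piece 0) {G : Matrix (Fin n) (Fin n) S⟦X⟧}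
    (hG : G ∈ ((F.powerSeries 3).matrix (Fin n)).piece 0)
    (hB : bSeries b - G ∈ ((F.powerSeries 3).matrix (Fin n)).piece (-1)) :
    dressedMatrix κ a e b - bSeries b + (scalarSeries κ n (shiftInv a) * (unitMatrix e * G) +
      G * (scalarSeries κ n (shiftInv (-a)) * unitMatrix e)) ∈
        ((F.powerSeries 3).matrix (Fin n)).piece (-4) := by
  set H := (F.powerSeries 3).matrix (Fin n) with hH
  have ha' : κ (-a) ∈ F.piece 3 := by simpa using ha
  have ht := map_shiftInv_mem F ha
  have ht' := map_shiftInv_mem F ha'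
  have hT : scalarSeries κ n (shiftInv a) ∈ H.piece (-3) :=
    (F.powerSeries 3).scalar_mem ht
  have hT' : scalarSeries κ n (shiftInv (-a)) ∈ H.piece (-3) :=
    (F.powerSeries 3).scalar_mem ht'
  have hs : PowerSeries.map κ (dressScalar a) ∈ (F.powerSeries 3).piece 0 := by
    refine F.geometric_mem (w := PowerSeries.map κ (shiftInv (-a) * shiftInv (-a))) ?_ ?_ ?_
    · rw [map_mul]
      exact (F.powerSeries 3).mul_mem_of_le (by norm_num) ht' ht'
    · simp [shiftInv, PowerSeries.coeff_mul]
    · rw [← map_mul, ← map_one (PowerSeries.map κ), ← map_add]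
      congr 1
      linear_combination dressScalar_mul a
  have hσ : scalarSeries κ n (dressScalar a) ∈ H.piece 0 := (F.powerSeries 3).scalar_mem hs
  have hσe : scalarSeries κ n (dressScalar a) = 1 + scalarSeries κ n (shiftInv (-a)) *
      scalarSeries κ n (shiftInv (-a)) * scalarSeries κ n (dressScalar a) := by
    rw [← map_mul, ← map_mul, ← map_one (scalarSeries κ n), ← map_add]
    congr 1
    linear_combination dressScalar_mul a
  have hp : unitMatrix e ∈ H.piece 0 := fun i j => F.C_mem (he j i)
  unfold dressedMatrix
  generalize scalarSeries κ n (shiftInv a) = T at *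
  generalize scalarSeries κ n (shiftInv (-a)) = T' at *
  generalize scalarSeries κ n (dressScalar a) = σ at *
  generalize unitMatrix e = p at *
  obtain ⟨B', hB'⟩ : ∃ B', B' = bSeries b - G := ⟨_, rfl⟩
  have hBG : bSeries b = G + B' := by rw [hB']; abel
  rw [← hB'] at hB
  rw [hBG]
  have hθ := H.mul_mem (H.mul_mem hT' hT') hσ
  have hTp := H.mul_mem hT hp
  have hTp' := H.mul_mem hT' hp
  obtain ⟨θ, hθe⟩ : ∃ θ, θ = T' * T' * σ := ⟨_, rfl⟩
  rw [← hθe] at hσe hθ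
  rw [hσe]
  have hB0 := H.mem_of_le (j := 0) (by norm_num) hB
  have hGB := add_mem hG hB0
  have h1 := sub_mem H.one_mem (H.mem_of_le (j := 0) (by norm_num) hTp)
  have h1' := sub_mem H.one_mem (H.mem_of_le (j := 0) (by norm_num) hTp')
  -- Here $Tp$ and $T'p$ have degree $-3$, $B'$ has degree $-1$ and $\theta$ has degree $-6$. Each
  -- term left after removing the part linear in $T,T'$ with leading matrix $G$ has degree at most
  -- $-4$.
  have expand : (1 - T * p) * (G + B') * ((1 + θ) * (1 - T' * p)) - (G + B') +
      (T * (p * G) + G * (T' * p)) = (1 - T * p) * (G + B') * (θ * (1 - T' * p)) +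
      T * p * (G + B') * (T' * p) - T * p * B' - B' * (T' * p) := by
    noncomm_ring
  rw [expand]
  refine sub_mem (sub_mem (add_mem ?_ ?_) ?_) ?_
  · exact H.mul_mem_of_le (by norm_num) (H.mul_mem h1 hGB) (H.mul_mem hθ h1')
  · exact H.mul_mem_of_le (by norm_num) (H.mul_mem hTp hGB) hTp'
  · exact H.mul_mem_of_le (by norm_num) hTp hB
  · exact H.mul_mem_of_le (by norm_num) hB hTp'

/-- Both $L(u)$ and $L(-u)^{-1}$ have constant term $1$. The universal property needs the leading
coefficient to stay $\mathrm{diag}(\varepsilon_i)$. -/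
lemma dressed_zero (i j : Fin n) : dressed κ a e b i j 0 = b i j 0 := by
  have h : (PowerSeries.constantCoeff (R := S)).mapMatrix (dressedMatrix κ a e b) =
      (PowerSeries.constantCoeff (R := S)).mapMatrix (bSeries b) := by
    have h0 : ∀ f : K⟦X⟧, (PowerSeries.constantCoeff (R := S)).mapMatrix (scalarSeries κ n f) =
        Matrix.scalar _ (κ (PowerSeries.constantCoeff f)) := fun f => by
      rw [scalarSeries, RingHom.comp_apply, mapMatrix_scalar,
        ← PowerSeries.coeff_zero_eq_constantCoeff_apply, PowerSeries.coeff_map,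
        PowerSeries.coeff_zero_eq_constantCoeff_apply]
    have h1 : ∀ a : K, PowerSeries.constantCoeff (shiftInv a) = 0 := fun a => by
      simp [shiftInv, PowerSeries.constantCoeff_mk]
    have h2 : PowerSeries.constantCoeff (dressScalar a) = 1 := by
      have := congrArg PowerSeries.constantCoeff (dressScalar_mul a)
      simpa [h1] using this
    simp only [dressedMatrix, map_mul, map_sub, map_one, h0, h1, h2, map_zero, zero_mul, sub_zero,
      one_mul, mul_one]
  have := congrFun (congrFun h i) j
  simpa [dressed, bSeries, PowerSeries.constantCoeff_mk] using this

end Approximation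

/-! ### The sign matrix, the parity condition and the constant solution -/

section Signs

variable {A : Type*} [Ring A] [Algebra ℂ A] (n l : ℕ)

/-- The leading coefficient `diag(ε₁, …, ε_n)` of `B(u)`. -/
noncomputable def signMatrix (A : Type*) [Ring A] [Algebra ℂ A] (n l : ℕ) :
    Matrix (Fin n) (Fin n) A⟦X⟧ :=
  Matrix.diagonal fun i => PowerSeries.C (algebraMap ℂ A (sgn n l i))

lemma sgn_mul_self (i : Fin n) : sgn n l i * sgn n l i = 1 := by
  unfold sgn
  split_ifs <;> norm_num

lemma signMatrix_mul_self : signMatrix A n l * signMatrix A n l = 1 := by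
  rw [signMatrix, Matrix.diagonal_mul_diagonal, ← Matrix.diagonal_one]
  congr 1
  ext i : 1
  rw [← map_mul, ← map_mul, sgn_mul_self, map_one, map_one]

lemma negArg_signMatrix : (negArg A).mapMatrix (signMatrix A n l) = signMatrix A n l := by
  ext i j r
  by_cases h : i = j
  · subst h
    cases r <;> simp [signMatrix, coeff_negArg, PowerSeries.coeff_C]
  · simp [signMatrix, h]

variable {n l}

/-- This sum is the coefficient of $b_{ij}^{(r)}$ in the linear part of the unitary condition. -/
lemma sgn_add_ne_zero_of_parity {i j : Fin n} {r : ℕ}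
    (h : ¬ ((Odd r ∧ SameBlock n l i j) ∨ (Even r ∧ ¬ SameBlock n l i j))) :
    (-1) ^ r * sgn n l i + sgn n l j ≠ 0 := by
  unfold SameBlock at h
  unfold sgn
  rcases Nat.even_or_odd r with hr | hr
  · rw [hr.neg_one_pow]
    have := Nat.not_odd_iff_even.2 hr
    split_ifs <;> first | (exfalso; tauto) | norm_num
  · rw [hr.neg_one_pow]
    have := Nat.not_even_iff_odd.2 hr
    split_ifs <;> first | (exfalso; tauto) | norm_num

/-- This is, up to sign, the leading coefficient in the coaction of $b_{ij}^{(r+1)}$. Shifting $r$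
by one exchanges the two parity classes, so the previous lemma applies. -/
lemma sgn_sub_ne_zero_of_parity {i j : Fin n} {r : ℕ}
    (h : (Odd (r + 1) ∧ SameBlock n l i j) ∨ (Even (r + 1) ∧ ¬ SameBlock n l i j)) :
    sgn n l j + (-1) ^ r * sgn n l i ≠ 0 := by
  rw [add_comm]
  refine sgn_add_ne_zero_of_parity ?_
  rw [Nat.odd_add_one, Nat.even_add_one, Nat.not_odd_iff_even, Nat.not_even_iff_odd] at h
  rcases h with ⟨h1, h2⟩ | ⟨h1, h2⟩
  · have := Nat.not_odd_iff_even.2 h1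
    tauto
  · have := Nat.not_even_iff_odd.2 h1
    tauto

/-- The family `B(u) = diag(ε₁, …, ε_n)`. -/
noncomputable def constFamily (n l : ℕ) (i j : Fin n) : ℕ → ℂ
  | 0 => if i = j then sgn n l i else 0
  | _ + 1 => 0

lemma bSeries_constFamily : bSeries (constFamily n l) = signMatrix ℂ n l := by
  ext i j r
  by_cases h : i = j
  · subst h
    cases r <;> simp [bSeries, signMatrix, constFamily, PowerSeries.coeff_C]
  · cases r <;> simp [bSeries, signMatrix, constFamily, h]

/-- Constant involutions solve the reflection equation. -/
lemma constant_reflection {Z M : Type*} [CommRing Z] [Ring M] [Algebra Z M] {P B₁ B₂ : M}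
    (hP : P * P = 1) (h1 : B₁ * B₁ = 1) (h2 : B₂ * B₂ = 1) (hP1 : P * B₁ = B₂ * P)
    (hP2 : P * B₂ = B₁ * P) (h12 : B₁ * B₂ = B₂ * B₁) {α β γ : Z} :
    (α • (1 : M) - γ • P) * B₁ * (β • (1 : M) - γ • P) * B₂ =
      B₂ * (β • (1 : M) - γ • P) * B₁ * (α • (1 : M) - γ • P) := by
  have r1 : B₁ * P * B₂ = P := by rw [← hP2, mul_assoc, h2, mul_one]
  have r2 : B₂ * P * B₁ = P := by rw [← hP1, mul_assoc, h1, mul_one]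
  have r3 : P * B₁ * P * B₂ = 1 := by rw [mul_assoc P, mul_assoc P, r1, hP]
  have r5 : B₂ * B₁ * P = P * B₁ * B₂ := by rw [hP1, mul_assoc, ← hP2, mul_assoc]
  simp only [mul_sub, sub_mul, mul_one, one_mul, smul_mul_assoc, mul_smul_comm, smul_sub,
    smul_smul, r1, r2, r3, r5, hP, h12]
  module

lemma isReflectionFamily_constFamily : IsReflectionFamily (constFamily n l) := by
  constructor
  · have hs := signMatrix_mul_self (A := ℂ) n l
    -- A constant matrix is the same in either variable, so the flip interchanges $B_1$ and $B_2$.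
    have hV : (PowerSeries.map (PowerSeries.C (R := ℂ))).mapMatrix (signMatrix ℂ n l) =
        (PowerSeries.C (R := ℂ⟦X⟧)).mapMatrix (signMatrix ℂ n l) := by
      ext i j : 2
      by_cases h : i = j <;> simp [signMatrix, h]
    have hP := flipMatrix_mul_self (R := ℂ⟦X⟧⟦X⟧) (n := n)
    have h1 : matB1 (constFamily n l) * matB1 (constFamily n l) = 1 := by
      rw [matB1_eq, bSeries_constFamily, ← map_mul, ← map_mul, hs, map_one, map_one]
    have h2 : matB2 (constFamily n l) * matB2 (constFamily n l) = 1 := by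
      rw [matB2_eq, bSeries_constFamily, ← map_mul, ← map_mul, hs, map_one, map_one]
    have hP1 : flipMatrix _ n * matB1 (constFamily n l) =
        matB2 (constFamily n l) * flipMatrix _ n := by
      rw [matB1_eq, matB2_eq, bSeries_constFamily, hV, flipMatrix_mul_inFst]
    have hP2 : flipMatrix _ n * matB2 (constFamily n l) =
        matB1 (constFamily n l) * flipMatrix _ n := by
      rw [matB1_eq, matB2_eq, bSeries_constFamily, hV, flipMatrix_mul_inSnd]
    have h12 : matB1 (constFamily n l) * matB2 (constFamily n l) =
        matB2 (constFamily n l) * matB1 (constFamily n l) := by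
      rw [matB1_eq, matB2_eq]
      exact commute_inFst_inSnd fun _ _ _ _ => Commute.all _ _
    unfold reflLHS reflRHS RMinus RPlus
    generalize matB1 (constFamily n l) = B₁ at *
    generalize matB2 (constFamily n l) = B₂ at *
    generalize flipMatrix ℂ⟦X⟧⟦X⟧ n = P at *
    exact constant_reflection hP h1 h2 hP1 hP2 h12
  · rw [unitaryProd_eq, bSeries_constFamily, negArg_signMatrix, signMatrix_mul_self]

end Signs
end ReflAlg

namespace ReflAlg

open scoped Kronecker PowerSeries

lemma IsReflectionFamily.map {S T : Type*} [Ring S] [Ring T] {n : ℕ} (f : S →+* T)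
    {b : Fin n → Fin n → ℕ → S} (hb : IsReflectionFamily b) :
    IsReflectionFamily fun i j r => f (b i j r) :=
  ⟨by rw [← map_reflLHS, ← map_reflRHS, hb.1], by rw [← map_unitaryProd, hb.2, map_one]⟩

end ReflAlg

/-! ### Universal property, weight filtration and spanning -/

namespace ReflectionAlgebra

open ReflAlg
open scoped PowerSeries

variable {n l : ℕ}

/-- The quotient map from the free algebra. -/
noncomputable def mk (n l : ℕ) : Free n →ₐ[ℂ] ReflectionAlgebra n l :=
  RingQuot.mkAlgHom ℂ (Rel n l)

lemma mk_freeB (i j : Fin n) (r : ℕ) : mk n l (freeB n l i j r) = b n l i j r := rfl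

lemma mk_rel {x y : Free n} (h : Rel n l x y) : mk n l x = mk n l y :=
  RingQuot.mkAlgHom_rel ℂ h

lemma mk_surjective : Function.Surjective (mk n l) := RingQuot.mkAlgHom_surjective ℂ _

lemma b_zero (i j : Fin n) :
    b n l i j 0 = if i = j then algebraMap ℂ (ReflectionAlgebra n l) (sgn n l i) else 0 := by
  rw [← mk_freeB, freeB]
  split_ifs
  · exact (mk n l).commutes _
  · exact map_zero _

lemma isReflectionFamily_b : IsReflectionFamily (b n l) := by
  constructor
  · have h1 := map_reflLHS (mk n l : Free n →+* ReflectionAlgebra n l) (freeB n l)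
    have h2 := map_reflRHS (mk n l : Free n →+* ReflectionAlgebra n l) (freeB n l)
    change _ = reflLHS (b n l) at h1
    change _ = reflRHS (b n l) at h2
    rw [← h1, ← h2]
    ext p q d c
    simpa using mk_rel (Rel.reflection p q c d)
  · have h1 := map_unitaryProd (mk n l : Free n →+* ReflectionAlgebra n l) (freeB n l)
    change _ = unitaryProd (b n l) at h1
    rw [← h1, ← map_one (PowerSeries.map (mk n l : Free n →+* ReflectionAlgebra n l)).mapMatrix]
    ext i j c
    simpa using mk_rel (Rel.unitary i j c)

/-- The universal property of the reflection algebra. -/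
lemma exists_lift {S : Type*} [Ring S] [Algebra ℂ S] {c : Fin n → Fin n → ℕ → S}
    (h0 : ∀ i j, c i j 0 = if i = j then algebraMap ℂ S (sgn n l i) else 0)
    (hc : IsReflectionFamily c) :
    ∃ f : ReflectionAlgebra n l →ₐ[ℂ] S, ∀ i j r, f (b n l i j r) = c i j r := by
  set φ : Free n →ₐ[ℂ] S := FreeAlgebra.lift ℂ fun x => c x.1 x.2.1 x.2.2 with hφ
  have hφb : ∀ i j r, φ (freeB n l i j r) = c i j r := by
    intro i j r
    rcases r with _ | r
    · rw [freeB, h0]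
      split_ifs
      · exact φ.commutes _
      · exact map_zero _
    · rw [freeB, hφ, FreeAlgebra.lift_ι_apply]
      rfl
  have hφc : (fun i j r => (φ : Free n →+* S) (freeB n l i j r)) = c := by
    funext i j r
    exact hφb i j r
  have hrel : ∀ ⦃x y : Free n⦄, Rel n l x y → φ x = φ y := by
    intro x y h
    cases h with
    | reflection p q u v =>
      have h1 := map_reflLHS (φ : Free n →+* S) (freeB n l)
      have h2 := map_reflRHS (φ : Free n →+* S) (freeB n l)
      rw [hφc] at h1 h2
      have h3 := congrFun (congrFun (h1.trans (hc.1.trans h2.symm)) p) q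
      have h4 := congrArg (fun f => PowerSeries.coeff u (PowerSeries.coeff v f)) h3
      simpa using h4
    | unitary i j u =>
      have h1 := map_unitaryProd (φ : Free n →+* S) (freeB n l)
      rw [hφc, hc.2, ← map_one (PowerSeries.map (φ : Free n →+* S)).mapMatrix] at h1
      have h3 := congrFun (congrFun h1 i) j
      have h4 := congrArg (fun f => PowerSeries.coeff u f) h3
      simpa using h4
  refine ⟨RingQuot.liftAlgHom ℂ ⟨φ, hrel⟩, fun i j r => ?_⟩
  exact (RingQuot.liftAlgHom_mkAlgHom_apply ℂ φ hrel _).trans (hφb i j r)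

/-- All generators `b_{ij}^{(r)}`, `r ≥ 1`. -/
noncomputable def gen (x : Fin n × Fin n × ℕ+) : ReflectionAlgebra n l := b n l x.1 x.2.1 x.2.2

/-- The weight `3r - 1` of the generator `b_{ij}^{(r)}`. -/
def weight (x : Fin n × Fin n × ℕ+) : ℕ := 3 * x.2.2 - 1

lemma weight_cast (x : Fin n × Fin n × ℕ+) : (weight x : ℤ) = 3 * (x.2.2 : ℕ) - 1 := by
  have := x.2.2.pos
  unfold weight
  omega

/-- The filtration of the reflection algebra by the weight of words. -/
noncomputable def filtration (n l : ℕ) : RingFiltration (ReflectionAlgebra n l) :=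
  wordFiltration ℂ (gen (n := n) (l := l)) weight

lemma mem_filtration {m : ℤ} {x : ReflectionAlgebra n l} :
    x ∈ (filtration n l).piece m ↔ x ∈ wordSpan ℂ (gen (n := n) (l := l)) weight m := Iff.rfl

lemma algebraMap_mem (z : ℂ) :
    algebraMap ℂ (ReflectionAlgebra n l) z ∈ (filtration n l).piece 0 := by
  rw [Algebra.algebraMap_eq_smul_one]
  exact Submodule.smul_mem _ z (filtration n l).one_mem

lemma b_succ_mem (i j : Fin n) (r : ℕ) (hr : 1 ≤ r) :
    b n l i j r ∈ (filtration n l).piece (3 * r - 1) := by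
  have := gen_mem_wordSpan (k := ℂ) (gen (n := n) (l := l)) weight (i, j, ⟨r, hr⟩)
  rw [weight_cast] at this
  exact this

lemma b_mem (i j : Fin n) (r : ℕ) : b n l i j r ∈ (filtration n l).piece (3 * r) := by
  rcases r with _ | r
  · rw [b_zero]
    split_ifs
    · simpa using algebraMap_mem _
    · exact zero_mem _
  · exact (filtration n l).mem_of_le (by omega) (b_succ_mem i j (r + 1) (by omega))

/-- The commutator bound $3(r+s)-3$ equals $(3r-1)+(3s-1)-1$; this fixes the slope $3$ in the
weight. -/
lemma gen_commutator_mem (x y : Fin n × Fin n × ℕ+) :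
    gen (l := l) x * gen y - gen y * gen x ∈
      wordSpan ℂ (gen (n := n) (l := l)) weight ((weight x : ℤ) + weight y - 1) := by
  have := (filtration n l).commutator_mem (k := 3) (by norm_num) isReflectionFamily_b.1 b_mem
    x.1 x.2.1 y.1 y.2.1 x.2.2 y.2.2
  refine wordSpan_mono _ _ (le_of_eq ?_) this
  rw [weight_cast, weight_cast]
  ring

lemma signMatrix_mem : signMatrix (ReflectionAlgebra n l) n l ∈
    (((filtration n l).powerSeries 3).matrix (Fin n)).piece 0 := by
  intro i j
  by_cases h : i = j
  · subst h
    rw [signMatrix, Matrix.diagonal_apply_eq]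
    exact (filtration n l).C_mem (algebraMap_mem _)
  · rw [signMatrix, Matrix.diagonal_apply_ne _ h]
    exact zero_mem _

lemma coeff_bSeries_sub_signMatrix_zero (i j : Fin n) :
    PowerSeries.coeff 0 ((bSeries (b n l) - signMatrix (ReflectionAlgebra n l) n l) i j) = 0 := by
  by_cases h : i = j
  · subst h; simp [bSeries, signMatrix, b_zero]
  · simp [bSeries, signMatrix, b_zero, h]

lemma coeff_bSeries_sub_signMatrix_succ (i j : Fin n) (r : ℕ) :
    PowerSeries.coeff (r + 1) ((bSeries (b n l) - signMatrix (ReflectionAlgebra n l) n l) i j) = b n l i j (r + 1) := by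
  by_cases h : i = j
  · subst h; simp [bSeries, signMatrix]
  · simp [bSeries, signMatrix, h]

lemma bSeries_sub_signMatrix_mem : bSeries (b n l) - signMatrix (ReflectionAlgebra n l) n l ∈
    (((filtration n l).powerSeries 3).matrix (Fin n)).piece (-1) := by
  intro i j r
  rcases r with _ | r
  · rw [coeff_bSeries_sub_signMatrix_zero]
    exact zero_mem _
  · rw [coeff_bSeries_sub_signMatrix_succ]
    exact (filtration n l).mem_of_le (by push_cast; linarith) (b_succ_mem i j (r + 1) (by omega))

/-- The index of a PBW generator among all generators. -/
def PBWIndex.toIndex (g : PBWIndex n l) : Fin n × Fin n × ℕ+ := (g.row, g.col, ⟨g.level, g.level_pos⟩)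

/-- Writing $B=G+B'$ with $G=\mathrm{diag}(\varepsilon_i)$, the unitary condition equates the part
linear in $B'$ with a product of two factors of degree $-1$. At level $r$ this product has weight at
most $3r-2$, one below the generator. -/
lemma gen_mem_of_not_mem_range (x : Fin n × Fin n × ℕ+)
    (hx : x ∉ Set.range (PBWIndex.toIndex (n := n) (l := l))) :
    gen x ∈ wordSpan ℂ (gen (n := n) (l := l)) weight ((weight x : ℤ) - 1) := by
  obtain ⟨i, j, r, hr⟩ := x
  have hpar : ¬ ((Odd r ∧ SameBlock n l i j) ∨ (Even r ∧ ¬ SameBlock n l i j)) := fun h =>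
    hx ⟨⟨i, j, r, hr, h⟩, rfl⟩
  have hz := sgn_add_ne_zero_of_parity hpar
  have hu := (isReflectionFamily_b (n := n) (l := l)).2
  rw [unitaryProd_eq] at hu
  set H := ((filtration n l).powerSeries 3).matrix (Fin n) with hH
  have hB := bSeries_sub_signMatrix_mem (n := n) (l := l)
  set G := signMatrix (ReflectionAlgebra n l) n l with hG
  have hGG : G * G = 1 := signMatrix_mul_self n l
  have hGn : (negArg _).mapMatrix G = G := negArg_signMatrix n l
  set B' := bSeries (b n l) - G with hB'
  have hBG : bSeries (b n l) = G + B' := by rw [hB']; abel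
  have hN : (negArg _).mapMatrix B' ∈ H.piece (-1) := by
    intro i j r
    rw [RingHom.mapMatrix_apply, Matrix.map_apply, coeff_negArg]
    rcases Nat.even_or_odd r with h | h
    · rw [h.neg_one_pow, one_mul]; exact hB i j r
    · rw [h.neg_one_pow, neg_one_mul]; exact neg_mem (hB i j r)
  have hlin : G * (negArg _).mapMatrix B' + B' * G = -(B' * (negArg _).mapMatrix B') := by
    rw [hBG, map_add, hGn, add_mul, mul_add, mul_add, hGG] at hu
    have := sub_eq_zero.2 hu
    rw [← sub_eq_zero, ← this]
    abel
  have hmem := neg_mem (H.mul_mem hB hN)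
  rw [← hlin] at hmem
  have hij := hmem i j r
  obtain ⟨s, rfl⟩ : ∃ s, r = s + 1 := ⟨r - 1, by omega⟩
  rw [Matrix.add_apply, hG, signMatrix, Matrix.diagonal_mul, Matrix.mul_diagonal, map_add,
    PowerSeries.coeff_C_mul, PowerSeries.coeff_mul_C, RingHom.mapMatrix_apply, Matrix.map_apply,
    coeff_negArg, hB', coeff_bSeries_sub_signMatrix_succ, ← Algebra.commutes, ← Algebra.smul_def,
    ← Algebra.smul_def] at hij
  have hb : ((-1) ^ (s + 1) * sgn n l i + sgn n l j) • b n l i j (s + 1) ∈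
      wordSpan ℂ (gen (n := n) (l := l)) weight (-1 + -1 + 3 * (s + 1 : ℕ)) := by
    have e : ((-1) ^ (s + 1) * sgn n l i + sgn n l j) • b n l i j (s + 1) =
        sgn n l i • ((-1) ^ (s + 1) * b n l i j (s + 1)) + sgn n l j • b n l i j (s + 1) := by
      rw [add_smul, mul_comm, mul_smul]
      congr 2
      rw [Algebra.smul_def]
      simp
    rw [e]
    exact hij
  have := Submodule.smul_mem _ ((-1) ^ (s + 1) * sgn n l i + sgn n l j)⁻¹ hb
  rw [smul_smul, inv_mul_cancel₀ hz, one_smul] at this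
  refine wordSpan_mono _ _ (le_of_eq ?_) this
  rw [weight_cast]
  simp only [PNat.mk_coe]
  ring

lemma exists_mem_wordSpan (x : ReflectionAlgebra n l) :
    ∃ m : ℕ, x ∈ wordSpan ℂ (gen (n := n) (l := l)) weight ((m : ℤ) - 1) := by
  obtain ⟨y, rfl⟩ := mk_surjective x
  induction y using FreeAlgebra.induction with
  | grade0 z =>
    refine ⟨1, ?_⟩
    rw [AlgHom.commutes]
    simpa using mem_filtration.1 (algebraMap_mem (n := n) (l := l) z)
  | grade1 z =>
    obtain ⟨i, j, r, hr⟩ := z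
    obtain ⟨s, rfl⟩ : ∃ s, r = s + 1 := ⟨r - 1, by omega⟩
    refine ⟨3 * (s + 1) + 1, ?_⟩
    have := b_mem (n := n) (l := l) i j (s + 1)
    refine wordSpan_mono _ _ (by push_cast; linarith) this
  | mul x y hx hy =>
    obtain ⟨p, hp⟩ := hx
    obtain ⟨q, hq⟩ := hy
    refine ⟨p + q, ?_⟩
    rw [map_mul]
    exact wordSpan_mono _ _ (by push_cast; linarith) (mul_mem_wordSpan _ _ hp hq)
  | add x y hx hy =>
    obtain ⟨p, hp⟩ := hx
    obtain ⟨q, hq⟩ := hy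
    refine ⟨p + q, ?_⟩
    rw [map_add]
    exact add_mem (wordSpan_mono _ _ (by push_cast; linarith) hp)
      (wordSpan_mono _ _ (by push_cast; linarith) hq)

lemma pbwGen_eq : (pbwGen : PBWIndex n l → ReflectionAlgebra n l) = gen ∘ PBWIndex.toIndex := rfl

lemma span_sorted_eq_top [LinearOrder (PBWIndex n l)] :
    Submodule.span ℂ (Set.range fun L : {L : List (PBWIndex n l) // L.Pairwise (fun g h => g ≤ h)} =>
      (L.1.map pbwGen).prod) = ⊤ := by
  rw [eq_top_iff]
  intro x _
  obtain ⟨m, hm⟩ := exists_mem_wordSpan x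
  exact wordSpan_le_span_sorted PBWIndex.toIndex gen_commutator_mem gen_mem_of_not_mem_range m hm

end ReflectionAlgebra

/-! ### The coaction and its leading term -/

namespace ReflectionAlgebra

open ReflAlg
open scoped PowerSeries

variable {n l : ℕ}

/-- The algebra of matrices over polynomials in a spectral parameter. -/
abbrev LoopMatrix (A : Type*) [Ring A] (n : ℕ) : Type _ := Matrix (Fin n) (Fin n) (Polynomial A)

/-- The constant scalar matrices. -/
noncomputable def constMat (A : Type*) [Ring A] (n : ℕ) : A →+* LoopMatrix A n :=
  (Matrix.scalar (Fin n)).comp Polynomial.C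

lemma constMat_apply {A : Type*} [Ring A] (x : A) (i j : Fin n) :
    constMat A n x i j = if i = j then Polynomial.C x else 0 := by
  simp [constMat, Matrix.diagonal_apply]

lemma constMat_algebraMap {A : Type*} [Ring A] [Algebra ℂ A] (z : ℂ) :
    constMat A n (algebraMap ℂ A z) = algebraMap ℂ (LoopMatrix A n) z := by
  ext i j : 2
  rw [constMat_apply, Matrix.algebraMap_matrix_apply, Polynomial.algebraMap_apply]

/-- The spectral parameter as a central element. -/
noncomputable def spectral (A : Type*) [Ring A] (n : ℕ) : Subring.center (LoopMatrix A n) :=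
  ⟨Matrix.scalar (Fin n) Polynomial.X, Subring.mem_center_iff.2 fun M =>
    (commute_scalar (fun f => Polynomial.commute_X f) M).symm.eq⟩

/-- The matrix units over polynomials. -/
noncomputable def unitMat (A : Type*) [Ring A] (n : ℕ) (i j : Fin n) : LoopMatrix A n :=
  Matrix.single i j 1

lemma unitMat_mul (A : Type*) [Ring A] (i j k m : Fin n) :
    unitMat A n i j * unitMat A n k m = if j = k then unitMat A n i m else 0 := by
  unfold unitMat
  split_ifs with h
  · subst h; simp
  · simp [h]

lemma sum_unitMat (A : Type*) [Ring A] : ∑ i, unitMat A n i i = 1 := by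
  ext i j : 2
  simp [unitMat, Matrix.sum_apply, Matrix.single_apply, Matrix.one_apply, ite_and]

lemma commute_constMat_unitMat {A : Type*} [Ring A] (x : A) (i j : Fin n) :
    Commute (constMat A n x) (unitMat A n i j) := by
  ext p q : 2
  rw [constMat, RingHom.comp_apply, Matrix.scalar_apply, Matrix.diagonal_mul, Matrix.mul_diagonal,
    unitMat, Matrix.single_apply]
  split_ifs <;> simp

/-- The family `L(u) B(u) L(-u)⁻¹` over the loop matrix algebra. -/
noncomputable def dressedB (n l : ℕ) :
    Fin n → Fin n → ℕ → LoopMatrix (ReflectionAlgebra n l) n :=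
  dressed (Subring.center _).subtype (spectral _ n) (unitMat _ n)
    fun i j r => constMat _ n (b n l i j r)

lemma isReflectionFamily_dressedB : IsReflectionFamily (dressedB n l) :=
  IsReflectionFamily.dressed (fun k s => (Subring.mem_center_iff.1 k.2 s).symm) (unitMat_mul _)
    (sum_unitMat _) (fun _ _ _ _ _ => commute_constMat_unitMat _ _ _)
    (isReflectionFamily_b.map (constMat _ n))

lemma dressedB_zero (i j : Fin n) : dressedB n l i j 0 =
    if i = j then algebraMap ℂ (LoopMatrix (ReflectionAlgebra n l) n) (sgn n l i) else 0 := by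
  rw [dressedB, dressed_zero, b_zero]
  split_ifs
  · exact constMat_algebraMap _
  · exact map_zero _

/-- The homomorphism dressing the reflection algebra by the evaluation representation. -/
noncomputable def coaction (n l : ℕ) :
    ReflectionAlgebra n l →ₐ[ℂ] LoopMatrix (ReflectionAlgebra n l) n :=
  (exists_lift dressedB_zero isReflectionFamily_dressedB).choose

lemma coaction_b (i j : Fin n) (r : ℕ) : coaction n l (b n l i j r) = dressedB n l i j r :=
  (exists_lift dressedB_zero isReflectionFamily_dressedB).choose_spec i j r

/-- The filtration of the loop matrix algebra. -/
noncomputable def loopFiltration (n l : ℕ) :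
    RingFiltration (LoopMatrix (ReflectionAlgebra n l) n) :=
  ((filtration n l).polynomial 3).matrix (Fin n)

lemma constMat_mem {m : ℤ} {x : ReflectionAlgebra n l} (hx : x ∈ (filtration n l).piece m) :
    constMat _ n x ∈ (loopFiltration n l).piece m :=
  ((filtration n l).polynomial 3).scalar_mem ((filtration n l).polynomial_C_mem hx)

lemma spectral_mem : (Subring.center _).subtype (spectral (ReflectionAlgebra n l) n) ∈
    (loopFiltration n l).piece 3 := by
  refine ((filtration n l).polynomial 3).scalar_mem fun p => ?_
  by_cases h : p = 1
  · subst h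
    simpa using (filtration n l).one_mem
  · rw [Polynomial.coeff_X_of_ne_one h]
    exact zero_mem _

lemma unitMat_mem (i j : Fin n) : unitMat _ n i j ∈ (loopFiltration n l).piece 0 := by
  intro p q
  rw [unitMat, Matrix.single_apply]
  split_ifs
  · exact RingFiltration.one_mem _
  · exact zero_mem _

/-- The leading term of the image of `b_{ij}^{(r+1)}` under the coaction. -/
noncomputable def leadingTerm (n l : ℕ) (i j : Fin n) (r : ℕ) :
    LoopMatrix (ReflectionAlgebra n l) n :=
  Matrix.single j i (Polynomial.C (algebraMap ℂ _ (-(sgn n l j + (-1) ^ r * sgn n l i))) *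
    Polynomial.X ^ r)

lemma spectral_pow_mul_unitMat (i j : Fin n) (r : ℕ) (z : ℂ) :
    (Subring.center _).subtype (spectral (ReflectionAlgebra n l) n) ^ r *
      (unitMat _ n i j * constMat _ n (algebraMap ℂ _ z)) =
    Matrix.single i j (Polynomial.C (algebraMap ℂ (ReflectionAlgebra n l) z) *
      Polynomial.X ^ r) := by
  have : (Subring.center _).subtype (spectral (ReflectionAlgebra n l) n) ^ r =
      Matrix.scalar (Fin n) (Polynomial.X ^ r) := by
    rw [map_pow]; rfl
  rw [this]
  ext p q : 2
  by_cases h : i = p <;> by_cases h' : j = q <;>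
    simp [constMat, unitMat, h, h', Polynomial.X_pow_mul]

/-- The coefficients of $u^{-(r+1)}$ in $(u-a)^{-1}$ and $(u+a)^{-1}$ are $a^r$ and $(-a)^r$.
Multiplied by the signs from $G$ on either side of $B(u)$, they give the leading term. The error is
three below the weight of the generator. -/
lemma coaction_b_approx (i j : Fin n) (r : ℕ) :
    coaction n l (b n l i j (r + 1)) - constMat _ n (b n l i j (r + 1)) - leadingTerm n l i j r ∈
      (loopFiltration n l).piece (3 * (r + 1) - 4) := by
  set G := (PowerSeries.map (constMat _ n)).mapMatrix (signMatrix (ReflectionAlgebra n l) n l)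
    with hG
  have hmap : ∀ {m : ℤ} {M : Matrix (Fin n) (Fin n) (ReflectionAlgebra n l)⟦X⟧},
      M ∈ (((filtration n l).powerSeries 3).matrix (Fin n)).piece m →
      (PowerSeries.map (constMat _ n)).mapMatrix M ∈
        (((loopFiltration n l).powerSeries 3).matrix (Fin n)).piece m := by
    intro m M hM p q c
    rw [RingHom.mapMatrix_apply, Matrix.map_apply, PowerSeries.coeff_map]
    exact constMat_mem (hM p q c)
  have hbS : bSeries (fun i j r => constMat _ n (b n l i j r)) =
      (PowerSeries.map (constMat _ n)).mapMatrix (bSeries (b n l)) := by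
    ext p q c : 3
    simp [bSeries]
  have h := dressedMatrix_approx (b := fun i j r => constMat _ n (b n l i j r))
    (loopFiltration n l) spectral_mem unitMat_mem (hmap signMatrix_mem)
    (by rw [hbS, ← map_sub]; exact hmap bSeries_sub_signMatrix_mem) i j (r + 1)
  rw [← hG] at h
  have hGe : ∀ p q, G p q = if p = q then
      PowerSeries.C (constMat _ n (algebraMap ℂ _ (sgn n l p))) else 0 := by
    intro p q
    by_cases hpq : p = q
    · subst hpq; simp [hG, signMatrix]
    · simp [hG, signMatrix, hpq]
  set κ := (Subring.center (LoopMatrix (ReflectionAlgebra n l) n)).subtype with hκ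
  set a := spectral (ReflectionAlgebra n l) n with ha
  set U : Matrix (Fin n) (Fin n) (LoopMatrix (ReflectionAlgebra n l) n)⟦X⟧ :=
    unitMatrix (unitMat (ReflectionAlgebra n l) n) with hU
  have hT : ∀ f p q, (scalarSeries κ n f * U) p q =
      PowerSeries.map κ f * PowerSeries.C (unitMat _ n q p) := fun f p q =>
    scalarSeries_mul_unitMatrix_apply f p q
  have e1 : PowerSeries.coeff (r + 1) ((scalarSeries κ n (shiftInv a) * (U * G)) i j) =
      κ a ^ r * (unitMat _ n j i * constMat _ n (algebraMap ℂ _ (sgn n l j))) := by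
    rw [← mul_assoc, Matrix.mul_apply]
    simp only [hT, hGe, mul_ite, mul_zero, Finset.sum_ite_eq', Finset.mem_univ, if_true]
    rw [mul_assoc, ← map_mul, PowerSeries.coeff_mul_C, coeff_map_shiftInv_succ]
  have e2 : PowerSeries.coeff (r + 1) ((G * (scalarSeries κ n (shiftInv (-a)) * U)) i j) =
      κ a ^ r * (unitMat _ n j i * constMat _ n (algebraMap ℂ _ ((-1) ^ r * sgn n l i))) := by
    rw [Matrix.mul_apply]
    simp only [hT, hGe, ite_mul, zero_mul, Finset.sum_ite_eq, Finset.mem_univ, if_true]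
    rw [PowerSeries.coeff_C_mul, PowerSeries.coeff_mul_C, coeff_map_shiftInv_succ, map_neg, neg_pow]
    have hc : ∀ M, constMat _ n (algebraMap ℂ _ (sgn n l i)) * M =
        M * constMat (ReflectionAlgebra n l) n (algebraMap ℂ _ (sgn n l i)) := fun M => by
      rw [constMat_algebraMap, Algebra.commutes]
    rcases Nat.even_or_odd r with hr | hr
    · rw [hr.neg_one_pow, hr.neg_one_pow, one_mul, one_mul, hc, mul_assoc]
    · rw [hr.neg_one_pow, hr.neg_one_pow, neg_one_mul, neg_one_mul, map_neg, map_neg, hc, mul_assoc]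
      simp only [neg_mul, mul_neg]
  rw [Matrix.add_apply, Matrix.add_apply, Matrix.sub_apply, map_add, map_add, map_sub, e1, e2,
    spectral_pow_mul_unitMat, spectral_pow_mul_unitMat] at h
  have e3 : PowerSeries.coeff (r + 1) (bSeries (fun i j r => constMat _ n (b n l i j r)) i j) =
      constMat _ n (b n l i j (r + 1)) := by simp [bSeries]
  rw [e3, ← Matrix.single_add, ← add_mul, ← map_add, ← map_add] at h
  rw [coaction_b, sub_eq_add_neg _ (leadingTerm n l i j r), leadingTerm, Matrix.single_neg,
    map_neg, map_neg, neg_mul, neg_neg]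
  refine (loopFiltration n l).mem_of_le (le_of_eq ?_) h
  push_cast
  ring

end ReflectionAlgebra

/-! ### Approximate partial derivatives and independence -/

namespace ReflectionAlgebra

open ReflAlg
open scoped PowerSeries

variable {n l : ℕ}

lemma leadingTerm_mem (i j : Fin n) (r : ℕ) :
    leadingTerm n l i j r ∈ (loopFiltration n l).piece (3 * r) := by
  intro p q
  rw [leadingTerm, Matrix.single_apply]
  split_ifs
  · intro s
    rw [Polynomial.coeff_C_mul_X_pow]
    split_ifs with h
    · subst h
      rw [sub_self]
      exact algebraMap_mem _
    · exact zero_mem _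
  · exact zero_mem _

lemma coaction_mul_sub (x y : ReflectionAlgebra n l) :
    coaction n l (x * y) - constMat _ n (x * y) =
      (coaction n l x - constMat _ n x) * constMat _ n y +
      constMat _ n x * (coaction n l y - constMat _ n y) +
      (coaction n l x - constMat _ n x) * (coaction n l y - constMat _ n y) := by
  rw [map_mul, map_mul]
  noncomm_ring

/-- The drop by $2$ comes from the leading term: $a^r$ has degree $3r$, while $b_{ij}^{(r+1)}$ has
weight $3r+2$. -/
lemma coaction_gen_sub_mem (x : Fin n × Fin n × ℕ+) :
    coaction n l (gen x) - constMat _ n (gen x) ∈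
      (loopFiltration n l).piece (weight x - 2) := by
  obtain ⟨i, j, r, hr⟩ := x
  obtain ⟨s, rfl⟩ : ∃ s, r = s + 1 := ⟨r - 1, by omega⟩
  have h1 := (loopFiltration n l).mem_of_le (j := 3 * s) (by linarith)
    (coaction_b_approx (l := l) i j s)
  have h2 := add_mem h1 (leadingTerm_mem i j s)
  rw [sub_add_cancel] at h2
  refine (loopFiltration n l).mem_of_le (le_of_eq ?_) h2
  rw [weight_cast]
  simp only [PNat.mk_coe]
  push_cast
  ring

/-- By `coaction_mul_sub` the drop by $2$ passes from letters to words, the term with two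
differences dropping even by $4$. -/
lemma coaction_sub_mem {m : ℤ} {x : ReflectionAlgebra n l} (hx : x ∈ (filtration n l).piece m) :
    coaction n l x - constMat _ n x ∈ (loopFiltration n l).piece (m - 2) := by
  have hword : ∀ L : List (Fin n × Fin n × ℕ+), coaction n l (L.map gen).prod -
      constMat _ n (L.map gen).prod ∈
        (loopFiltration n l).piece (((L.map weight).sum : ℕ) - 2) := by
    intro L
    induction L with
    | nil => simp [zero_mem]
    | cons x L ih =>
      simp only [List.map_cons, List.prod_cons, List.sum_cons, Nat.cast_add]
      rw [coaction_mul_sub]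
      have hg := coaction_gen_sub_mem (l := l) x
      have hx := constMat_mem (mem_filtration.2 (gen_mem_wordSpan (k := ℂ) (gen (l := l)) weight x))
      have hw := constMat_mem (mem_filtration.2
        (word_mem_wordSpan (k := ℂ) (gen (l := l)) weight (L := L) le_rfl))
      refine add_mem (add_mem ?_ ?_) ?_
      · exact RingFiltration.mul_mem_of_le _ (by linarith) hg hw
      · exact RingFiltration.mul_mem_of_le _ (by linarith) hx ih
      · exact RingFiltration.mul_mem_of_le _ (by linarith) hg ih
  rw [mem_filtration, wordSpan] at hx
  induction hx using Submodule.span_induction with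
  | mem x h =>
    obtain ⟨L, hL, rfl⟩ := h
    exact (loopFiltration n l).mem_of_le (by linarith) (hword L)
  | zero => simp [zero_mem]
  | add x y _ _ hx hy =>
    rw [map_add, map_add, add_sub_add_comm]
    exact add_mem hx hy
  | smul z x _ hx =>
    have : coaction n l (z • x) - constMat _ n (z • x) =
        constMat _ n (algebraMap ℂ _ z) * (coaction n l x - constMat _ n x) := by
      rw [Algebra.smul_def, map_mul, map_mul, AlgHom.commutes, constMat_algebraMap, mul_sub]
    rw [this]
    exact RingFiltration.mul_mem_of_le _ (by linarith) (constMat_mem (algebraMap_mem z)) hx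

/-- The operator which acts, to leading order, as the partial derivative with respect to a PBW
generator. -/
noncomputable def deriv (h : PBWIndex n l) : ReflectionAlgebra n l →ₗ[ℂ] ReflectionAlgebra n l where
  toFun x := ((coaction n l x - constMat _ n x) h.col h.row).coeff (h.level - 1)
  map_add' x y := by
    rw [map_add, map_add, add_sub_add_comm, Matrix.add_apply, Polynomial.coeff_add]
  map_smul' z x := by
    have : constMat _ n (z • x) = z • constMat (ReflectionAlgebra n l) n x := by
      rw [Algebra.smul_def, map_mul, constMat_algebraMap, ← Algebra.smul_def]
    rw [map_smul, this, ← smul_sub, Matrix.smul_apply, Polynomial.coeff_smul, RingHom.id_apply]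

lemma deriv_apply (h : PBWIndex n l) (x : ReflectionAlgebra n l) :
    deriv h x = ((coaction n l x - constMat _ n x) h.col h.row).coeff (h.level - 1) := rfl

lemma weight_toIndex (h : PBWIndex n l) : (weight h.toIndex : ℤ) = 3 * (h.level - 1 : ℕ) + 2 := by
  have := h.level_pos
  rw [weight_cast, PBWIndex.toIndex]
  simp only [PNat.mk_coe]
  omega

lemma coeff_mem {h : PBWIndex n l} {m k : ℤ} {M : LoopMatrix (ReflectionAlgebra n l) n}
    (hM : M ∈ (loopFiltration n l).piece m) (hk : m + 2 - weight h.toIndex ≤ k) :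
    (M h.col h.row).coeff (h.level - 1) ∈ wordSpan ℂ (gen (n := n) (l := l)) weight k := by
  refine wordSpan_mono _ _ ?_ (hM h.col h.row (h.level - 1))
  rw [weight_toIndex] at hk
  linarith

lemma deriv_mem (h : PBWIndex n l) (m : ℤ) (x : ReflectionAlgebra n l)
    (hx : x ∈ wordSpan ℂ (gen (n := n) (l := l)) weight m) :
    deriv h x ∈ wordSpan ℂ (gen (n := n) (l := l)) weight (m - weight h.toIndex) :=
  coeff_mem (coaction_sub_mem hx) (by linarith)

/-- The defect is a coefficient of the product of two differences, which drops by $4$ instead of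
$2$. -/
lemma deriv_leibniz (h : PBWIndex n l) (i j : ℤ) (x y : ReflectionAlgebra n l)
    (hx : x ∈ wordSpan ℂ (gen (n := n) (l := l)) weight i)
    (hy : y ∈ wordSpan ℂ (gen (n := n) (l := l)) weight j) :
    deriv h (x * y) - (deriv h x * y + x * deriv h y) ∈
      wordSpan ℂ (gen (n := n) (l := l)) weight (i + j - weight h.toIndex - 1) := by
  have h1 := RingFiltration.mul_mem _ (coaction_sub_mem (mem_filtration.2 hx))
    (coaction_sub_mem (mem_filtration.2 hy))
  have h2 := coeff_mem (h := h) (k := i + j - weight h.toIndex - 1) h1 (by linarith)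
  convert h2 using 1
  simp only [deriv_apply, coaction_mul_sub]
  rw [Matrix.add_apply, Matrix.add_apply, Polynomial.coeff_add, Polynomial.coeff_add,
    sub_eq_iff_eq_add, add_comm]
  congr 2
  · rw [constMat, RingHom.comp_apply, RingHom.comp_apply, Matrix.scalar_apply, Matrix.scalar_apply,
      Matrix.mul_diagonal, Polynomial.coeff_mul_C]
  · rw [constMat, RingHom.comp_apply, RingHom.comp_apply, Matrix.scalar_apply, Matrix.scalar_apply,
      Matrix.diagonal_mul, Polynomial.coeff_C_mul]

/-- The leading coefficient of `deriv h` on the PBW generator with index `h`. -/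
noncomputable def derivCoeff (h : PBWIndex n l) : ℂ :=
  -(sgn n l h.col + (-1) ^ (h.level - 1) * sgn n l h.row)

lemma derivCoeff_ne_zero (h : PBWIndex n l) : derivCoeff h ≠ 0 := by
  refine neg_ne_zero.2 (sgn_sub_ne_zero_of_parity ?_)
  rw [Nat.sub_add_cancel h.level_pos]
  exact h.parity

lemma toIndex_injective : Function.Injective (PBWIndex.toIndex (n := n) (l := l)) := by
  rintro ⟨i, j, r, hr, hp⟩ ⟨i', j', r', hr', hp'⟩ h
  have h1 : i = i' := congrArg Prod.fst h
  have h2 : j = j' := congrArg (fun x => x.2.1) h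
  have h3 : r = r' := congrArg (fun x => x.2.2.val) h
  subst h1 h2 h3
  rfl

/-- The leading term is the single monomial $a^{r-1}$ in the transposed position, column index
first. It therefore meets the coefficient read off by `deriv h` only when row, column and level all
agree. -/
lemma deriv_gen [DecidableEq (PBWIndex n l)] (h x : PBWIndex n l) :
    deriv h (gen x.toIndex) - (if x = h then algebraMap ℂ _ (derivCoeff h) else 0) ∈
      wordSpan ℂ (gen (n := n) (l := l)) weight ((weight x.toIndex : ℤ) - weight h.toIndex - 1) := by
  have hl := x.level_pos
  have h1 := coaction_b_approx (l := l) x.row x.col (x.level - 1)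
  rw [Nat.sub_add_cancel hl] at h1
  have h2 := coeff_mem (h := h) (k := (weight x.toIndex : ℤ) - weight h.toIndex - 1) h1
    (by rw [weight_toIndex x]; linarith)
  convert h2 using 1
  rw [Matrix.sub_apply, Polynomial.coeff_sub]
  congr 1
  rw [leadingTerm, Matrix.single_apply]
  by_cases hxh : x = h
  · subst hxh
    simp only [and_self, if_true]
    rw [Polynomial.coeff_C_mul_X_pow, if_pos rfl, derivCoeff]
  · rw [if_neg hxh]
    split_ifs with hrc
    · rw [Polynomial.coeff_C_mul_X_pow, if_neg]
      intro hlev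
      have := h.level_pos
      refine hxh (toIndex_injective ?_)
      have hlev' : x.level = h.level := by omega
      exact Prod.ext hrc.2 (Prod.ext hrc.1 (PNat.eq hlev'))
    · simp

lemma deriv_one (h : PBWIndex n l) : deriv h 1 = 0 := by
  simp [deriv_apply]

lemma linearIndependent_sorted [LinearOrder (PBWIndex n l)] :
    LinearIndependent ℂ fun L : {L : List (PBWIndex n l) // L.Pairwise (fun g h => g ≤ h)} =>
      (L.1.map pbwGen).prod := by
  -- The character $B(u)\mapsto\mathrm{diag}(\varepsilon_i)$ provides a functional that does not
  -- vanish at $1$; nothing else about it is used.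
  obtain ⟨φ, -⟩ := exists_lift (S := ℂ) (n := n) (l := l) (c := constFamily n l)
    (fun i j => by simp [constFamily]) isReflectionFamily_constFamily
  have hφ : φ.toLinearMap 1 ≠ 0 := by
    rw [AlgHom.toLinearMap_apply, map_one]
    exact one_ne_zero
  have hpos : ∀ h : PBWIndex n l, 0 < weight h.toIndex := fun h => by
    have := weight_toIndex h
    omega
  rw [pbwGen_eq]
  exact linearIndependent_sorted_words (good := PBWIndex.toIndex) (D := deriv) (c := derivCoeff)
    (φ := φ.toLinearMap) hpos deriv_mem deriv_leibniz deriv_one deriv_gen derivCoeff_ne_zero hφ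

end ReflectionAlgebra

theorem corollary3p2 (n l : ℕ) (hl : l ≤ n)
    [LinearOrder (ReflectionAlgebra.PBWIndex n l)] :
    ∃ β : Module.Basis
        {L : List (ReflectionAlgebra.PBWIndex n l) // L.Pairwise (fun g h => g ≤ h)}
        ℂ (ReflectionAlgebra n l),
      ∀ L, β L = (L.1.map ReflectionAlgebra.pbwGen).prod :=
  ⟨Module.Basis.mk ReflectionAlgebra.linearIndependent_sorted
    ReflectionAlgebra.span_sorted_eq_top.ge, fun L => Module.Basis.mk_apply _ _ L⟩
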